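/- Let $r,j\ge 1$ and $n\ge 0$ be integers and let $m=rn+j$. Let $\Pi_m^{r,j}$ be the set of all partitions of $\{1,\dots,m\}$ in which the block containing $m$ has at least $j$ elements and every other block has cardinality divisible by $r$, ordered by refinement, together with an adjoined minimal element $\hat 0$; its maximal element $\hat 1$ is the one-block partition. Let $\rho$ be its rank function ($\rho(x)$ is the length of a longest chain with top element $x$). Label the edges $x\prec y$ of the Hasse diagram as follows. * If $x\ne\hat 0$ and $y$ arises from $x$ by merging the blocks $B_1,B_2$ with $\max B_1<\max B_2$, then $\lambda(x,y)=-\max B_1$ if $\max B_1>\min B_2$, and $\lambda(x,y)=\max B_2$ otherwise. * For an atom $a$ let $\widetilde a$ be the word obtained by ordering the blocks of $a$ by their minima and writing the elements of each block in increasing order. Let $a_1,\dots,a_M$ be the atoms, ordered so that $\widetilde a_1<\dots<\widetilde a_M$ lexicographically, and put $\lambda(\hat 0,a_i)=0_i$. The labels are ordered by $-m<\dots<-1<0_1<\dots<0_M<1<\dots<m$. Pairs $(\lambda(x,y),-\rho(x))$ are ordered lexicographically. An edge labeling of a graded bounded poset is an *EL-labeling* if every interval $[x,y]$ has exactly one rising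 maximal chain (one whose labels strictly increase from bottom to top), and the label sequence of that chain is lexicographically smaller than that of every other maximal chain of $[x,y]$. A maximal chain from $\hat 0$ to $\hat 1$ is *falling* if its labels weakly decrease from bottom to top. Let $A_m^{r,j}$ be the set of permutations $\sigma$ of $\{1,\dots,m\}$ with descent set $\{r,2r,\dots,nr\}$ and $\sigma(m)=m$. For $\sigma\in A_m^{r,j}$ let $t_1,\dots,t_n$ be the arrangement of $1,\dots,n$ with $\sigma(rt_1)>\sigma(rt_2)>\dots>\sigma(rt_n)$, and let $f_\sigma$ be the chain consisting of $\hat 0$ and, for $i=n+1,n,\dots,1$, the partition whose $i$ blocks are the sets of entries of the words obtained by splitting $\sigma(1)\sigma(2)\cdots\sigma(m)$ after the positions $rt_1,\dots,rt_{i-1}$. **Theorem.** The poset $\Pi_m^{r,j}$ is graded (the rank increases by one along every edge of its Hasse diagram), the labeling $(x,y)\mapsto(\lambda(x,y),-\rho(x))$ is an EL-labeling of it, and the set of its falling maximal chains is exactly $\{f_\sigma : \sigma\in A_m^{r,j}\}$. -/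

import Mathlib

/-! ### Edge labelings of a bounded poset -/

namespace EdgeLabeling

variable {P Λ : Type*}

/-- `c` is a saturated chain `x = c₀ ⋖ c₁ ⋖ ⋯ ⋖ cₖ = y`, that is, a maximal chain of the
interval `[x, y]`. -/
def IsMaximalChain [Preorder P] (x y : P) (c : List P) : Prop :=
  c.head? = some x ∧ c.getLast? = some y ∧ c.IsChain (· ⋖ ·)

/-- The sequence of labels `ℓ c₀ c₁, ℓ c₁ c₂, …` of the edges of a chain. -/
def labels (ℓ : P → P → Λ) (c : List P) : List Λ := List.zipWith ℓ c c.tail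

/-- The labels strictly increase along `c`. -/
def IsRising [LT Λ] (ℓ : P → P → Λ) (c : List P) : Prop := (labels ℓ c).IsChain (· < ·)

/-- The labels weakly decrease along `c`. -/
def IsFalling [LE Λ] (ℓ : P → P → Λ) (c : List P) : Prop := (labels ℓ c).IsChain (· ≥ ·)

/-- `ℓ` (of which only the values `ℓ x y` with `x ⋖ y` matter) is an EL-labeling: every interval
`[x, y]` has exactly one rising maximal chain, and the label sequence of that chain is
lexicographically smaller than the one of any other maximal chain of the interval. -/
def IsELLabeling [PartialOrder P] [PartialOrder Λ] (ℓ : P → P → Λ) : Prop :=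
  ∀ x y : P, x ≤ y → ∃ c, IsMaximalChain x y c ∧ IsRising ℓ c ∧
    ∀ d, IsMaximalChain x y d → d ≠ c → ¬ IsRising ℓ d ∧ labels ℓ c < labels ℓ d

/-- The rank of `x`: the length of a longest chain with top element `x`. -/
noncomputable def rank [Preorder P] (x : P) : ℕ := (Order.height x).toNat

/-- A poset is graded by the rank function if the rank goes up by one along every edge of the
Hasse diagram. -/
def IsGraded (P : Type*) [Preorder P] : Prop :=
  ∀ x y : P, x ⋖ y → rank y = rank x + 1

end EdgeLabeling

/-! ### The extended `r`-divisible partition lattice `Π_m^{r,j}`, where `m = r n + j` -/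

namespace ExtendedPartition

open EdgeLabeling

/-- Partitions of `{1, …, r n + j}`, ordered by refinement. -/
abbrev Part (r n j : ℕ) : Type := Finpartition (Finset.Icc 1 (r * n + j))

/-- The block containing `m = r n + j` has at least `j` elements; the cardinality of every other
block is divisible by `r`. -/
def Admissible (r n j : ℕ) (π : Part r n j) : Prop :=
  ∀ B ∈ π.parts, (r * n + j ∈ B → j ≤ B.card) ∧ (r * n + j ∉ B → r ∣ B.card)

/-- The admissible partitions, ordered by refinement. -/
abbrev AdmPart (r n j : ℕ) : Type := {π : Part r n j // Admissible r n j π}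

/-- The one-block partition is the maximal element. -/
instance (r n j : ℕ) : OrderTop (AdmPart r n j) where
  top := ⟨⊤, by
    intro B hB
    have hB' : B = Finset.Icc 1 (r * n + j) :=
      Finset.mem_singleton.1 (Finpartition.parts_top_subset _ hB)
    obtain ⟨x, hx⟩ := Finpartition.nonempty_of_mem_parts _ hB
    subst hB'
    rw [Finset.mem_Icc] at hx
    refine ⟨fun _ => by simp, fun h => ?_⟩
    exact absurd (Finset.mem_Icc.2 ⟨by omega, le_rfl⟩) h⟩
  le_top π := show (π : Part r n j) ≤ ⊤ from le_top

/-- The poset `Π_m^{r,j}`: the admissible partitions with a minimal element `0̂ = ⊥` adjoined. -/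
abbrev Lat (r n j : ℕ) : Type := WithBot (AdmPart r n j)

/-- The maximum of a non-empty finite set. -/
def blockMax (B : Finset ℕ) : ℕ := B.max.unbotD 0

/-- The minimum of a non-empty finite set. -/
def blockMin (B : Finset ℕ) : ℕ := B.min.untopD 0

variable {r n j : ℕ}

/-- The blocks `B₁` and `B₂` of `x` are merged in `y`, and `max B₁ < max B₂`. -/
def IsMerge (x y : Part r n j) (B : Finset ℕ × Finset ℕ) : Prop :=
  B.1 ∈ x.parts ∧ B.2 ∈ x.parts ∧ B.1 ∪ B.2 ∈ y.parts ∧ blockMax B.1 < blockMax B.2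

/-- The integer label of the edge that merges `B₁` and `B₂`, where `max B₁ < max B₂`. -/
def mergeLabel (B : Finset ℕ × Finset ℕ) : ℤ :=
  if blockMin B.2 < blockMax B.1 then -(blockMax B.1 : ℤ) else (blockMax B.2 : ℤ)

/-- The word `ã` of a partition: the blocks are ordered by their minima, and the elements of each
block are written in increasing order. -/
def word (a : Part r n j) : List ℕ :=
  ((a.parts.image blockMin).sort (· ≤ ·)).flatMap fun i => (a.part i).sort (· ≤ ·)

/-- The position (counted from `1`) of an atom `a` in the list of all atoms, ordered
lexicographically by their words. -/
noncomputable def atomIndex (a : AdmPart r n j) : ℕ :=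
  Set.ncard {b : AdmPart r n j | IsAtom (b : Lat r n j) ∧ word b.1 ≤ word a.1}

/-- The labels `-m < ⋯ < -1 < 0₁ < 0₂ < ⋯ < 0_M < 1 < ⋯ < m`, as pairs in lexicographic order:
`0ᵢ` is the pair `(0, i)`, and an integer `k ≠ 0` is the pair `(k, 0)`. -/
abbrev Label : Type := ℤ ×ₗ ℕ

open Classical in
/-- The labeling `λ`; the value is meaningful if `x ⋖ y`, in which case the two blocks of `x` that
are merged in `y` are unique. -/
noncomputable def lam : Lat r n j → Lat r n j → Label
  | WithBot.some x, WithBot.some y =>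
      if h : ∃ B, IsMerge x.1 y.1 B then toLex (mergeLabel h.choose, 0) else toLex (0, 0)
  | ⊥, WithBot.some a => toLex (0, atomIndex a)
  | _, ⊥ => toLex (0, 0)

/-- The labeling `(λ(x, y), -ρ(x))`; the pairs are ordered lexicographically. -/
noncomputable def pairLabel (x y : Lat r n j) : Label ×ₗ ℤ :=
  toLex (lam x y, -(rank x : ℤ))

/-! ### Permutations and the chains `f_σ` -/

/-- The permutations `σ` of `{1, …, m}`, `m = r n + j`, (extended by the identity to `ℕ`) with
descent set `{r, 2 r, …, n r}` and `σ m = m`. -/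
def descPerms (r n j : ℕ) : Set (Equiv.Perm ℕ) :=
  {σ | (∀ i, i ∉ Finset.Icc 1 (r * n + j) → σ i = i) ∧
    (∀ i, (1 ≤ i ∧ i < r * n + j ∧ σ (i + 1) < σ i) ↔ ∃ t, 1 ≤ t ∧ t ≤ n ∧ i = r * t) ∧
    σ (r * n + j) = r * n + j}

/-- The list `t₁, …, tₙ` of the numbers `1, …, n`, sorted so that
`σ (r t₁) > σ (r t₂) > ⋯ > σ (r tₙ)`. -/
def descOrder (r n : ℕ) (σ : Equiv.Perm ℕ) : List ℕ :=
  (List.range' 1 n).mergeSort fun s t => decide (σ (r * t) ≤ σ (r * s))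

/-- The number of splitting positions in `S` that precede the entry `a` of `σ(1) σ(2) ⋯ σ(m)`. -/
def cutIndex (σ : Equiv.Perm ℕ) (S : List ℕ) (a : ℕ) : ℕ :=
  (S.filter fun s => decide (s < σ.symm a)).length

/-- The partition of `{1, …, m}` into the sets of entries of the words obtained from the word
`σ(1) σ(2) ⋯ σ(m)` by splitting it after each of the positions in `S`: two entries lie in the same
block if the same number of splitting positions precedes them. -/
def splitAt (r n j : ℕ) (σ : Equiv.Perm ℕ) (S : List ℕ) : Part r n j :=
  @Finpartition.ofSetSetoid ℕ _ (Setoid.ker (cutIndex σ S)) (Finset.Icc 1 (r * n + j))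
    (fun a b => inferInstanceAs (Decidable (cutIndex σ S a = cutIndex σ S b)))

/-- The chain `f_σ`: first `0̂`, then for `i = n + 1, n, …, 1` the partition obtained by splitting
`σ` at `r t₁, …, r tᵢ₋₁`. -/
def fChain (r n j : ℕ) (σ : Equiv.Perm ℕ) : List (WithBot (Part r n j)) :=
  ⊥ :: (List.range (n + 1)).reverse.map fun k =>
    ((splitAt r n j σ (((descOrder r n σ).take k).map (r * ·)) : Part r n j) :
      WithBot (Part r n j))

/-- An element of `Π_m^{r,j}` as a partition or `0̂`. -/
def Lat.val (x : Lat r n j) : WithBot (Part r n j) := WithBot.map Subtype.val x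

end ExtendedPartition

/-! EL-property. By `isELLabeling_of_exists_first` it is enough to find in each interval one atom
`a` whose label is strictly least, below all labels of edges leaving `a`, while every other atom `b`
is followed by some edge whose label does not exceed that of `b`.

In `[x, y]` with `x ≠ 0̂`, the atoms are the pairs of blocks of `x` lying in one block of `y`. An
overlapping pair has a negative label, a pair of consecutive blocks a positive one. The pair of
least label is unique and has the required properties, by comparing minima and maxima of at most
four blocks (`IsFirstMerge`). The component `-ρ` turns equal values of `λ` into descents.

In `[0̂, y]`, exactly one atom cuts every block of `y` into consecutive pieces
(`IsSeparated.unique`), so all merges above it have positive labels. Any other atom has an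
overlapping pair, whose negative label lies below every `0_i`. Redistributing that pair into a lower
and an upper part makes the word smaller (`word_lt_of_exchange`), so the separated atom has the
least word.

Falling chains. After the label `0_i` all labels are negative: each step merges overlapping blocks
`B`, `C`, and the smaller maxima `max B` increase along the chain. Read from the top down, each step
splits a block, and placing `B` immediately before `C` yields a linear order on the blocks of the
atom in which neighbours overlap and the block of `m` is last (`IsFallingFrom.exists_isBlockOrder`).
Writing each block increasingly gives a permutation with descents exactly at the ends of the first
`n` blocks. Since maxima vanish in increasing order, the cuts still present are those with the
largest values, so the chain is `f_σ` (`IsBlockOrder.eq_splitAt_topCuts`). Conversely, removing the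
cut at `r t` from `f_σ` has label `-σ(r t)` (`lam_splitPart`), so `f_σ` falls. -/

namespace EdgeLabeling

/-! ### A local criterion for EL-labelings -/

section EL

variable {P Λ : Type*}

theorem labels_cons_cons (ℓ : P → P → Λ) (x y : P) (c : List P) :
    labels ℓ (x :: y :: c) = ℓ x y :: labels ℓ (y :: c) := rfl

variable [PartialOrder P]

theorem IsMaximalChain.le {x y : P} {c : List P} (h : IsMaximalChain x y c) : x ≤ y := by
  induction c generalizing x with
  | nil => simp [IsMaximalChain] at h
  | cons a c ih =>
    obtain ⟨h1, h2, h3⟩ := h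
    obtain rfl : a = x := by simpa using h1
    cases c with
    | nil => exact le_of_eq (by simpa using h2)
    | cons b c =>
      rw [List.isChain_cons_cons] at h3
      exact h3.1.le.trans (ih ⟨rfl, by simpa using h2, h3.2⟩)

theorem isMaximalChain_self (x : P) : IsMaximalChain x x [x] :=
  ⟨rfl, rfl, List.isChain_singleton _⟩

theorem IsMaximalChain.cons {x a y : P} {c : List P} (hx : x ⋖ a)
    (h : IsMaximalChain a y c) : IsMaximalChain x y (x :: c) := by
  obtain ⟨h1, h2, h3⟩ := h
  cases c with
  | nil => simp at h1
  | cons b c =>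
    obtain rfl : b = a := by simpa using h1
    exact ⟨rfl, by simpa using h2, List.isChain_cons_cons.2 ⟨hx, h3⟩⟩

theorem IsMaximalChain.exists_cons {x y : P} {c : List P} (h : IsMaximalChain x y c)
    (hxy : x ≠ y) : ∃ a l, c = x :: a :: l ∧ x ⋖ a ∧ IsMaximalChain a y (a :: l) := by
  obtain ⟨h1, h2, h3⟩ := h
  match c with
  | [] => simp at h1
  | [b] => simp_all
  | b :: a :: l =>
    obtain rfl : b = x := by simpa using h1
    rw [List.isChain_cons_cons] at h3
    exact ⟨a, l, rfl, h3.1, rfl, by simpa using h2, h3.2⟩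

theorem IsMaximalChain.eq_singleton {x : P} {c : List P} (h : IsMaximalChain x x c) :
    c = [x] := by
  obtain ⟨h1, h2, h3⟩ := h
  match c with
  | [] => simp at h1
  | [b] => simpa using h1
  | b :: a :: l =>
    obtain rfl : b = x := by simpa using h1
    rw [List.isChain_cons_cons] at h3
    have : IsMaximalChain a b (a :: l) := ⟨rfl, by simpa using h2, h3.2⟩
    exact absurd (h3.1.lt.trans_le this.le) (lt_irrefl _)

/-- A labeling is an EL-labeling if every interval `[x, y]` has a unique atom `a` with smallest
label, the labels of the edges from `a` within the interval are larger, and above any other atom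
`b` the interval contains an edge from `b` whose label does not exceed the label of `b`. -/
theorem isELLabeling_of_exists_first [Finite P] [PartialOrder Λ] (ℓ : P → P → Λ)
    (h : ∀ x y : P, x < y → ∃ a, x ⋖ a ∧ a ≤ y ∧
      (∀ b, x ⋖ b → b ≤ y → b ≠ a → ℓ x a < ℓ x b) ∧
      (∀ a', a ⋖ a' → a' ≤ y → ℓ x a < ℓ a a') ∧
      (∀ b, x ⋖ b → b ≤ y → b ≠ a → ∃ b', b ⋖ b' ∧ b' ≤ y ∧ ℓ b b' ≤ ℓ x b)) :
    IsELLabeling ℓ := by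
  intro x y
  induction x using WellFoundedGT.induction with
  | ind x ih =>
  intro hxy
  rcases hxy.eq_or_lt with rfl | hlt
  · exact ⟨[x], isMaximalChain_self x, List.isChain_nil,
      fun d hd hne => absurd hd.eq_singleton hne⟩
  obtain ⟨a, hxa, hay, h1, h2, h3⟩ := h x y hlt
  obtain ⟨c, hc, hcr, hcu⟩ := ih a hxa.lt hay
  have hhead : ∀ {z d}, IsMaximalChain z y d → ∃ l, d = z :: l := by
    rintro z (_ | ⟨w, l⟩) ⟨hd, -, -⟩
    · simp at hd
    · exact ⟨l, by simpa using hd⟩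
  obtain ⟨l, rfl⟩ := hhead hc
  refine ⟨x :: a :: l, hc.cons hxa, ?_, ?_⟩
  · rcases hay.eq_or_lt with rfl | hay
    · cases hc.eq_singleton
      exact List.isChain_singleton _
    · obtain ⟨a', l', hl, haa', hc'⟩ := hc.exists_cons hay.ne
      simp only [List.cons.injEq, true_and] at hl
      subst hl
      exact List.isChain_cons_cons.2 ⟨h2 a' haa' hc'.le, hcr⟩
  · intro d hd hne
    obtain ⟨b, l', rfl, hxb, hb⟩ := hd.exists_cons hlt.ne
    by_cases hba : b = a
    · subst hba
      obtain ⟨hr, hl⟩ := hcu _ hb (by simpa using hne)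
      refine ⟨fun hr' => hr ?_, ?_⟩
      · exact List.IsChain.tail hr'
      · rw [labels_cons_cons, labels_cons_cons]
        exact List.cons_lt_cons_iff.2 (Or.inr ⟨rfl, hl⟩)
    · refine ⟨fun hr => ?_, ?_⟩
      · obtain ⟨b', hbb', hby', hle⟩ := h3 b hxb hb.le hba
        have hby : b < y := hbb'.lt.trans_le hby'
        obtain ⟨c, hc, hcr, hcu⟩ := ih b hxb.lt hb.le
        obtain ⟨c', hc', -, -⟩ := ih b' (hxb.lt.trans hbb'.lt) hby'
        obtain ⟨m, rfl⟩ := hhead hc'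
        obtain ⟨b'', l'', hl, hb'', hl''⟩ := hb.exists_cons hby.ne
        simp only [List.cons.injEq, true_and] at hl
        subst hl
        have hr2 : IsRising ℓ (b :: b'' :: l'') := List.IsChain.tail hr
        -- The tail of a rising chain through `b` is the rising chain of `[b, y]`, which is
        -- lexicographically first there; its first label is thus at most `ℓ b b' ≤ ℓ x b`, and the
        -- chain does not rise at `b`.
        have hceq : b :: b'' :: l'' = c := by
          by_contra hcon
          exact (hcu _ hb hcon).1 hr2
        subst hceq
        have hlt' : ℓ x b < ℓ b b'' := (List.isChain_cons_cons.1 hr).1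
        have hle' : ℓ b b'' ≤ ℓ b b' := by
          by_cases he : b :: b' :: m = b :: b'' :: l''
          · simp only [List.cons.injEq, true_and] at he
            rw [he.1]
          · have := (hcu _ (hc'.cons hbb') he).2
            rw [labels_cons_cons, labels_cons_cons, List.cons_lt_cons_iff] at this
            rcases this with h | h
            · exact h.le
            · exact h.1.le
        exact absurd (hlt'.trans_le (hle'.trans hle)) (lt_irrefl _)
      · rw [labels_cons_cons, labels_cons_cons]
        exact List.cons_lt_cons_iff.2 (Or.inl (h1 b hxb hb.le hba))

end EL

/-! ### Rank functions determined by covers -/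

section Rank

variable {P : Type*} [PartialOrder P]

variable [Finite P]

theorem strictMono_of_covBy {g : P → ℕ} (hcov : ∀ x y : P, x ⋖ y → g y = g x + 1) :
    StrictMono g := by
  intro x y
  induction x using WellFoundedGT.induction with
  | ind x ih =>
  intro hxy
  obtain ⟨z, hxz, hzy⟩ := exists_covBy_le_of_lt hxy
  have h1 := hcov x z hxz
  rcases hzy.eq_or_lt with rfl | h
  · omega
  · have := ih z hxz.lt h
    omega

/-- Strict monotonicity of `g` bounds the height from above, and descending along covers attains the
bound. -/
theorem rank_eq_of_covBy [OrderBot P] {g : P → ℕ} (h0 : g ⊥ = 0)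
    (hcov : ∀ x y : P, x ⋖ y → g y = g x + 1) (x : P) : rank x = g x := by
  have hg := strictMono_of_covBy hcov
  suffices h : Order.height x = g x by simp [rank, h]
  induction x using WellFoundedLT.induction with
  | ind x ih =>
  apply le_antisymm
  · rw [Order.height_le_coe_iff]
    intro y hy
    rw [ih y hy]
    exact_mod_cast hg hy
  · rcases eq_or_ne x ⊥ with rfl | hx
    · simp [h0]
    · obtain ⟨z, -, hz⟩ := exists_le_covBy_of_lt (bot_lt_iff_ne_bot.2 hx)
      rw [hcov z x hz, Order.height_eq_iSup_lt_height]
      refine le_trans ?_ (le_iSup₂ (f := fun y (_ : y < x) => Order.height y + 1) z hz.lt)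
      simp only [ih z hz.lt]
      push_cast
      exact le_rfl

end Rank

end EdgeLabeling

/-! ### Replacing parts of a finite partition, and testing refinement on pairs of elements -/

namespace Finpartition

variable {α : Type*} [DecidableEq α] {s : Finset α}

/-- Replace the parts in `Q` by the parts in `Q'`, which have the same union. -/
def replaceParts (x : Finpartition s) (Q Q' : Finset (Finset α)) (hQ : Q ⊆ x.parts)
    (hd : (Q' : Set (Finset α)).PairwiseDisjoint id)
    (hU : Q'.biUnion id = Q.biUnion id) : Finpartition s :=
  ofPairwiseDisjoint ((x.parts \ Q) ∪ Q') (by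
    intro B hB C hC hBC
    have key : ∀ B ∈ x.parts \ Q, ∀ C ∈ Q', Disjoint B C := by
      intro B hB C hC
      rw [Finset.mem_sdiff] at hB
      rw [Finset.disjoint_left]
      intro e he he'
      have : e ∈ Q'.biUnion id := Finset.mem_biUnion.2 ⟨C, hC, he'⟩
      rw [hU, Finset.mem_biUnion] at this
      obtain ⟨D, hD, heD⟩ := this
      exact hB.2 (x.eq_of_mem_parts hB.1 (hQ hD) he heD ▸ hD)
    rw [Finset.mem_coe, Finset.mem_union] at hB hC
    rcases hB with hB | hB <;> rcases hC with hC | hC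
    · exact x.disjoint (Finset.mem_sdiff.1 hB).1 (Finset.mem_sdiff.1 hC).1 hBC
    · exact key B hB C hC
    · exact (key C hC B hB).symm
    · exact hd hB hC hBC) |>.copy (by
    rw [Finset.sup_union, Finset.sup_eq_biUnion Q', hU, ← Finset.sup_eq_biUnion,
      ← Finset.sup_union, Finset.sdiff_union_of_subset hQ, x.sup_parts])

/-- The underlying construction discards the empty set, whence the hypothesis `∅ ∉ Q'`. -/
theorem parts_replaceParts (x : Finpartition s) (Q Q' : Finset (Finset α)) (hQ : Q ⊆ x.parts)
    (hd : (Q' : Set (Finset α)).PairwiseDisjoint id) (hne : ∅ ∉ Q')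
    (hU : Q'.biUnion id = Q.biUnion id) :
    (x.replaceParts Q Q' hQ hd hU).parts = (x.parts \ Q) ∪ Q' := by
  have h : ∅ ∉ (x.parts \ Q) ∪ Q' := by
    simp [hne, x.empty_notMem_parts]
  simpa [replaceParts, ofPairwiseDisjoint] using h

theorem eq_of_subset_of_mem_parts (x : Finpartition s) {B C : Finset α} (hB : B ∈ x.parts)
    (hC : C ∈ x.parts) (h : B ⊆ C) : B = C := by
  obtain ⟨e, he⟩ := x.nonempty_of_mem_parts hB
  exact x.eq_of_mem_parts hB hC he (h he)

theorem part_subset_part {x y : Finpartition s} (h : x ≤ y) (e : α) : x.part e ⊆ y.part e := by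
  by_cases he : e ∈ s
  · obtain ⟨C, hC, hle⟩ := h (x.part_mem.2 he)
    rwa [y.part_eq_of_mem hC (hle (x.mem_part_self.2 he))]
  · rw [x.part_eq_empty.2 he]
    exact Finset.empty_subset _

theorem part_eq_part_of_le {x y : Finpartition s} (h : x ≤ y) {B : Finset α} (hB : B ∈ x.parts)
    {a b : α} (ha : a ∈ B) (hb : b ∈ B) : y.part a = y.part b := by
  obtain ⟨C, hC, hle⟩ := h hB
  rw [y.part_eq_of_mem hC (hle ha), y.part_eq_of_mem hC (hle hb)]

theorem le_of_part {x y : Finpartition s}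
    (h : ∀ a ∈ s, ∀ b ∈ s, x.part a = x.part b → y.part a = y.part b) : x ≤ y := by
  intro B hB
  obtain ⟨e, he⟩ := x.nonempty_of_mem_parts hB
  have hes := x.subset hB he
  refine ⟨y.part e, y.part_mem.2 hes, fun b hb => ?_⟩
  have hbs := x.subset hB hb
  rw [h e hes b hbs (by rw [x.part_eq_of_mem hB he, x.part_eq_of_mem hB hb])]
  exact y.mem_part_self.2 hbs

theorem eq_of_part {x y : Finpartition s}
    (h : ∀ a ∈ s, ∀ b ∈ s, x.part a = x.part b ↔ y.part a = y.part b) : x = y :=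
  le_antisymm (le_of_part fun a ha b hb => (h a ha b hb).1)
    (le_of_part fun a ha b hb => (h a ha b hb).2)

end Finpartition

namespace ExtendedPartition

open EdgeLabeling

/-! ### Maxima and minima of blocks -/

section Block

variable {B C : Finset ℕ} {e : ℕ}

theorem blockMax_mem (h : B.Nonempty) : blockMax B ∈ B := by
  obtain ⟨a, ha⟩ := Finset.max_of_nonempty h
  simpa [blockMax, ha] using Finset.mem_of_max ha

theorem le_blockMax (h : e ∈ B) : e ≤ blockMax B := by
  obtain ⟨a, ha⟩ := Finset.max_of_mem h
  simpa [blockMax, ha] using Finset.le_max_of_eq h ha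

theorem blockMin_mem (h : B.Nonempty) : blockMin B ∈ B := by
  obtain ⟨a, ha⟩ := Finset.min_of_nonempty h
  have := Finset.mem_of_min ha
  rw [blockMin, ha]
  exact this

theorem blockMin_le (h : e ∈ B) : blockMin B ≤ e := by
  obtain ⟨a, ha⟩ := Finset.min_of_mem h
  have := Finset.min_le_of_eq h ha
  rw [blockMin, ha]
  exact this

theorem blockMin_le_blockMax (h : B.Nonempty) : blockMin B ≤ blockMax B :=
  blockMin_le (blockMax_mem h)

theorem blockMax_eq (h : e ∈ B) (h' : ∀ a ∈ B, a ≤ e) : blockMax B = e :=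
  le_antisymm (h' _ (blockMax_mem ⟨e, h⟩)) (le_blockMax h)

theorem blockMin_eq (h : e ∈ B) (h' : ∀ a ∈ B, e ≤ a) : blockMin B = e :=
  le_antisymm (blockMin_le h) (h' _ (blockMin_mem ⟨e, h⟩))

theorem blockMax_union (hB : B.Nonempty) (hC : C.Nonempty) :
    blockMax (B ∪ C) = max (blockMax B) (blockMax C) := by
  have h1 := blockMax_mem hB
  have h2 := blockMax_mem hC
  apply blockMax_eq
  · rcases max_choice (blockMax B) (blockMax C) with h | h <;> rw [h] <;> simp [h1, h2]
  · intro a ha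
    rcases Finset.mem_union.1 ha with h | h
    · exact (le_blockMax h).trans (le_max_left _ _)
    · exact (le_blockMax h).trans (le_max_right _ _)

theorem blockMin_union (hB : B.Nonempty) (hC : C.Nonempty) :
    blockMin (B ∪ C) = min (blockMin B) (blockMin C) := by
  have h1 := blockMin_mem hB
  have h2 := blockMin_mem hC
  apply blockMin_eq
  · rcases min_choice (blockMin B) (blockMin C) with h | h <;> rw [h] <;> simp [h1, h2]
  · intro a ha
    rcases Finset.mem_union.1 ha with h | h
    · exact (min_le_left _ _).trans (blockMin_le h)
    · exact (min_le_right _ _).trans (blockMin_le h)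

end Block

/-! ### Cover relations are merges of two blocks -/

variable {r n j : ℕ}

/-- `y` arises from `x` by merging the blocks `B` and `C`, where `max B < max C`. -/
def Merges (x y : Part r n j) (B C : Finset ℕ) : Prop :=
  B ∈ x.parts ∧ C ∈ x.parts ∧ blockMax B < blockMax C ∧ y.parts = x.parts \ {B, C} ∪ {B ∪ C}

theorem blockMax_ne {x : Part r n j} {B C : Finset ℕ} (hB : B ∈ x.parts) (hC : C ∈ x.parts)
    (h : B ≠ C) : blockMax B ≠ blockMax C := fun he =>
  h (x.eq_of_mem_parts hB hC (blockMax_mem (x.nonempty_of_mem_parts hB))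
    (he ▸ blockMax_mem (x.nonempty_of_mem_parts hC)))

/-- Merging preserves admissibility: sizes divisible by `r` add up, and the block of `m` only grows.
-/
theorem exists_merges {x : AdmPart r n j} {B C : Finset ℕ} (hB : B ∈ x.1.parts)
    (hC : C ∈ x.1.parts) (h : blockMax B < blockMax C) :
    ∃ y : AdmPart r n j, Merges x.1 y.1 B C := by
  have hne : B ≠ C := by rintro rfl; exact h.false
  have hBn := x.1.nonempty_of_mem_parts hB
  have hp := x.1.parts_replaceParts {B, C} {B ∪ C} (by simp [Finset.insert_subset_iff, hB, hC])
    (by simp) (fun h => hBn.ne_empty (Finset.union_eq_empty.1 (Finset.mem_singleton.1 h).symm).1) (by simp)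
  refine ⟨⟨x.1.replaceParts {B, C} {B ∪ C} (by simp [Finset.insert_subset_iff, hB, hC])
    (by simp) (by simp), ?_⟩, hB, hC, h, hp⟩
  intro D hD
  rw [hp, Finset.mem_union, Finset.mem_singleton] at hD
  rcases hD with hD | rfl
  · exact x.2 D (Finset.mem_sdiff.1 hD).1
  · have hd : Disjoint B C := x.1.disjoint hB hC hne
    rw [Finset.card_union_of_disjoint hd]
    have h1 := x.2 B hB
    have h2 := x.2 C hC
    constructor
    · intro hm
      rcases Finset.mem_union.1 hm with hm | hm
      · have := h1.1 hm; omega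
      · have := h2.1 hm; omega
    · intro hm
      rw [Finset.mem_union, not_or] at hm
      exact dvd_add (h1.2 hm.1) (h2.2 hm.2)

namespace Merges

variable {x y : Part r n j} {B C : Finset ℕ}

theorem ne (h : Merges x y B C) : B ≠ C := by
  rintro rfl; exact h.2.2.1.false

theorem union_mem (h : Merges x y B C) : B ∪ C ∈ y.parts := by
  rw [h.2.2.2]; simp

theorem mem_parts_iff (h : Merges x y B C) {D : Finset ℕ} :
    D ∈ y.parts ↔ D = B ∪ C ∨ D ∈ x.parts ∧ D ≠ B ∧ D ≠ C := by
  rw [h.2.2.2]; simp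

theorem le (h : Merges x y B C) : x ≤ y := by
  intro D hD
  by_cases h1 : D = B
  · exact ⟨_, h.union_mem, h1 ▸ Finset.subset_union_left⟩
  by_cases h2 : D = C
  · exact ⟨_, h.union_mem, h2 ▸ Finset.subset_union_right⟩
  exact ⟨D, h.mem_parts_iff.2 (Or.inr ⟨hD, h1, h2⟩), le_rfl⟩

theorem union_notMem (h : Merges x y B C) : B ∪ C ∉ x.parts := fun hU => h.ne <|
  (x.eq_of_subset_of_mem_parts h.1 hU Finset.subset_union_left).trans
    (x.eq_of_subset_of_mem_parts h.2.1 hU Finset.subset_union_right).symm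

theorem card (h : Merges x y B C) : x.parts.card = y.parts.card + 1 := by
  have hsub : ({B, C} : Finset (Finset ℕ)) ⊆ x.parts := by
    simp [Finset.insert_subset_iff, h.1, h.2.1]
  have h2 := Finset.card_le_card hsub
  have hU := h.union_notMem
  rw [Finset.card_pair h.ne] at h2
  rw [h.2.2.2, Finset.card_union_of_disjoint, Finset.card_sdiff_of_subset hsub,
    Finset.card_pair h.ne, Finset.card_singleton]
  · omega
  · simp [hU]

theorem lt (h : Merges x y B C) : x < y := lt_of_le_of_ne h.le fun he => by
  have := h.card
  rw [he] at this
  omega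

/-- The test used throughout for a merge to stay inside an interval; the maxima serve as
representatives of their blocks. -/
theorem le_iff (h : Merges x y B C) {z : Part r n j} (hz : x ≤ z) :
    y ≤ z ↔ z.part (blockMax B) = z.part (blockMax C) := by
  have hB := blockMax_mem (x.nonempty_of_mem_parts h.1)
  have hC := blockMax_mem (x.nonempty_of_mem_parts h.2.1)
  constructor
  · intro hyz
    exact Finpartition.part_eq_part_of_le hyz h.union_mem (Finset.mem_union_left _ hB)
      (Finset.mem_union_right _ hC)
  · intro he D hD
    rcases h.mem_parts_iff.1 hD with rfl | hD
    · refine ⟨z.part (blockMax B), z.part_mem.2 (x.subset h.1 hB), Finset.union_subset ?_ ?_⟩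
      · conv_lhs => rw [← x.part_eq_of_mem h.1 hB]
        exact Finpartition.part_subset_part hz _
      · rw [he]
        conv_lhs => rw [← x.part_eq_of_mem h.2.1 hC]
        exact Finpartition.part_subset_part hz _
    · exact hz hD.1

/-- This makes the choice in `lam` harmless. If the union were an old block of `x`, it would equal
both of the blocks it contains, against the strict inequality of the maxima. -/
theorem isMerge_unique (h : Merges x y B C) {D : Finset ℕ × Finset ℕ} (hD : IsMerge x y D) :
    D = (B, C) := by
  obtain ⟨D, E⟩ := D
  obtain ⟨h1, h2, h3, h4⟩ := hD
  dsimp only at h1 h2 h3 h4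
  rcases h.mem_parts_iff.1 h3 with h5 | h5
  · have key : ∀ F ∈ x.parts, F ⊆ B ∪ C → F = B ∨ F = C := by
      intro F hF hs
      obtain ⟨e, he⟩ := x.nonempty_of_mem_parts hF
      rcases Finset.mem_union.1 (hs he) with h' | h'
      · exact Or.inl (x.eq_of_mem_parts hF h.1 he h')
      · exact Or.inr (x.eq_of_mem_parts hF h.2.1 he h')
    have hlt := h.2.2.1
    rcases key D h1 (h5 ▸ Finset.subset_union_left) with rfl | rfl <;>
    rcases key E h2 (h5 ▸ Finset.subset_union_right) with rfl | rfl
    · exact absurd h4 (lt_irrefl _)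
    · rfl
    · exact absurd (h4.trans hlt) (lt_irrefl _)
    · exact absurd h4 (lt_irrefl _)
  · have e1 := x.eq_of_subset_of_mem_parts h1 h5.1 Finset.subset_union_left
    have e2 := x.eq_of_subset_of_mem_parts h2 h5.1 Finset.subset_union_right
    rw [e1.trans e2.symm] at h4
    exact absurd h4 (lt_irrefl _)

end Merges

theorem exists_merges_le {x y : AdmPart r n j} (h : x < y) :
    ∃ z : AdmPart r n j, ∃ B C, Merges x.1 z.1 B C ∧ z ≤ y := by
  obtain ⟨a, ha, b, hb, hy, hx⟩ : ∃ a ∈ Finset.Icc 1 (r * n + j), ∃ b ∈ Finset.Icc 1 (r * n + j),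
      y.1.part a = y.1.part b ∧ x.1.part a ≠ x.1.part b := by
    by_contra! hcon
    exact h.not_ge (Finpartition.le_of_part hcon)
  have key : ∀ B ∈ x.1.parts, ∀ e ∈ B, y.1.part (blockMax B) = y.1.part e := fun B hB e he =>
    Finpartition.part_eq_part_of_le h.le hB (blockMax_mem ⟨e, he⟩) he
  have hAp := x.1.part_mem.2 ha
  have hBp := x.1.part_mem.2 hb
  have k1 := key _ hAp a (x.1.mem_part_self.2 ha)
  have k2 := key _ hBp b (x.1.mem_part_self.2 hb)
  rcases lt_or_gt_of_ne (blockMax_ne hAp hBp hx) with hlt | hlt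
  · obtain ⟨z, hz⟩ := exists_merges hAp hBp hlt
    exact ⟨z, _, _, hz, (hz.le_iff h.le).2 (by rw [k1, k2, hy])⟩
  · obtain ⟨z, hz⟩ := exists_merges hBp hAp hlt
    exact ⟨z, _, _, hz, (hz.le_iff h.le).2 (by rw [k1, k2, hy])⟩

theorem card_parts_strictAnti : StrictAnti fun x : AdmPart r n j => x.1.parts.card := by
  intro x y h
  obtain ⟨z, B, C, hz, hzy⟩ := exists_merges_le h
  have := hz.card
  have := Finpartition.card_mono (show z.1 ≤ y.1 from hzy)
  dsimp only
  omega

/-- Below any larger element there is a merge, and a merge lowers the number of blocks by exactly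
one, so nothing fits in between. -/
theorem covBy_iff {x y : AdmPart r n j} : x ⋖ y ↔ ∃ B C, Merges x.1 y.1 B C := by
  constructor
  · intro h
    obtain ⟨z, B, C, hz, hzy⟩ := exists_merges_le h.lt
    obtain rfl := h.eq_or_eq (show x ≤ z from hz.le) hzy |>.resolve_left
      (ne_of_gt (show x < z from hz.lt))
    exact ⟨B, C, hz⟩
  · rintro ⟨B, C, h⟩
    refine ⟨h.lt, fun z h1 h2 => ?_⟩
    have := card_parts_strictAnti h1
    have := card_parts_strictAnti h2
    have := h.card
    dsimp only at *
    omega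

theorem lam_eq {x y : AdmPart r n j} {B C : Finset ℕ} (h : Merges x.1 y.1 B C) :
    lam (x : Lat r n j) (y : Lat r n j) = toLex (mergeLabel (B, C), 0) := by
  have hex : ∃ D, IsMerge x.1 y.1 D := ⟨(B, C), h.1, h.2.1, h.union_mem, h.2.2.1⟩
  have heq : lam (x : Lat r n j) (y : Lat r n j) = @dite _ (∃ D, IsMerge x.1 y.1 D)
    (Classical.propDecidable _) (fun h => toLex (mergeLabel h.choose, 0))
    (fun _ => toLex (0, 0)) := rfl
  rw [heq, dif_pos hex, h.isMerge_unique hex.choose_spec]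

/-! ### Minimal admissible partitions and the grading -/

theorem max_mem_Icc (hj : 0 < j) : r * n + j ∈ Finset.Icc 1 (r * n + j) :=
  Finset.mem_Icc.2 ⟨by omega, le_rfl⟩

theorem sum_card_erase (hj : 0 < j) (x : Part r n j) :
    ∑ B ∈ x.parts.erase (x.part (r * n + j)), B.card + (x.part (r * n + j)).card = r * n + j := by
  rw [Finset.sum_erase_add _ _ (x.part_mem.2 (max_mem_Icc hj)), x.sum_card_parts]
  simp

theorem notMem_of_mem_erase (x : Part r n j) {B : Finset ℕ}
    (hB : B ∈ x.parts.erase (x.part (r * n + j))) : r * n + j ∉ B := fun h => by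
  rw [Finset.mem_erase] at hB
  exact hB.1 (x.part_eq_of_mem hB.2 h).symm

theorem le_card_of_notMem {x : AdmPart r n j} {B : Finset ℕ} (hB : B ∈ x.1.parts)
    (hm : r * n + j ∉ B) : r ≤ B.card :=
  Nat.le_of_dvd (Finset.card_pos.2 (x.1.nonempty_of_mem_parts hB)) ((x.2 B hB).2 hm)

/-- One block has at least `j` elements and each other block at least `r`, out of `r n + j` in
total. -/
theorem card_parts_le (hr : 0 < r) (hj : 0 < j) (x : AdmPart r n j) :
    x.1.parts.card ≤ n + 1 := by
  have h1 := sum_card_erase hj x.1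
  have hmem := x.1.part_mem.2 (max_mem_Icc (r := r) (n := n) hj)
  have h2 := (x.2 _ hmem).1 (x.1.mem_part_self.2 (max_mem_Icc hj))
  have h3 : (x.1.parts.erase (x.1.part (r * n + j))).card * r ≤
      ∑ B ∈ x.1.parts.erase (x.1.part (r * n + j)), B.card := by
    rw [← smul_eq_mul]
    exact Finset.card_nsmul_le_sum _ _ _ fun B hB =>
      le_card_of_notMem (Finset.mem_of_mem_erase hB) (notMem_of_mem_erase _ hB)
  rw [Finset.card_erase_of_mem hmem] at h3
  have h4 : (x.1.parts.card - 1) * r ≤ n * r := by linarith [mul_comm r n]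
  have := Nat.le_of_mul_le_mul_right h4 hr
  omega

/-- The block sizes of the smallest admissible partitions. -/
def HasMinimalBlocks (x : Part r n j) : Prop :=
  ∀ B ∈ x.parts, (r * n + j ∈ B → B.card = j) ∧ (r * n + j ∉ B → B.card = r)

/-- The equality case of the count behind `card_parts_le`. -/
theorem card_parts_eq_iff (hr : 0 < r) (hj : 0 < j) (x : AdmPart r n j) :
    x.1.parts.card = n + 1 ↔ HasMinimalBlocks x.1 := by
  have h1 := sum_card_erase hj x.1
  have hmem := x.1.part_mem.2 (max_mem_Icc (r := r) (n := n) hj)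
  have hself := x.1.mem_part_self.2 (max_mem_Icc (r := r) (n := n) hj)
  have h2 := (x.2 _ hmem).1 hself
  constructor
  · intro hc
    have hle : ∀ B ∈ x.1.parts.erase (x.1.part (r * n + j)), r ≤ B.card := fun B hB =>
      le_card_of_notMem (Finset.mem_of_mem_erase hB) (notMem_of_mem_erase _ hB)
    have h3 : ∑ B ∈ x.1.parts.erase (x.1.part (r * n + j)), r = r * n := by
      rw [Finset.sum_const, Finset.card_erase_of_mem hmem, hc, smul_eq_mul, mul_comm]
      simp
    have h4 := Finset.sum_le_sum hle
    have h5 := (Finset.sum_eq_sum_iff_of_le hle).1 (by omega)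
    intro B hB
    refine ⟨fun hm => ?_, fun hm => ?_⟩
    · rw [← x.1.part_eq_of_mem hB hm]
      omega
    · refine (h5 B (Finset.mem_erase.2 ⟨?_, hB⟩)).symm
      rintro rfl
      exact hm hself
  · intro h
    rw [(h _ hmem).1 hself, Finset.sum_congr rfl fun B hB =>
      (h B (Finset.mem_of_mem_erase hB)).2 (notMem_of_mem_erase _ hB), Finset.sum_const,
      Finset.card_erase_of_mem hmem, smul_eq_mul] at h1
    have h4 : (x.1.parts.card - 1) * r = n * r := by linarith [mul_comm r n]
    have := Nat.eq_of_mul_eq_mul_right hr h4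
    have := Finset.card_pos.2 ⟨_, hmem⟩
    omega

/-- If the block of `m` has more than `j` elements, it therefore has at least `r` too many, enough
to split off a block. -/
theorem dvd_card_sub (hj : 0 < j) (x : AdmPart r n j) : r ∣ (x.1.part (r * n + j)).card - j := by
  have h1 := sum_card_erase hj x.1
  have hmem := x.1.part_mem.2 (max_mem_Icc (r := r) (n := n) hj)
  have h2 := (x.2 _ hmem).1 (x.1.mem_part_self.2 (max_mem_Icc hj))
  have h3 : r ∣ ∑ B ∈ x.1.parts.erase (x.1.part (r * n + j)), B.card :=
    Finset.dvd_sum fun B hB =>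
      (x.2 B (Finset.mem_of_mem_erase hB)).2 (notMem_of_mem_erase _ hB)
  have h4 : (x.1.part (r * n + j)).card - j = r * n -
      ∑ B ∈ x.1.parts.erase (x.1.part (r * n + j)), B.card := by omega
  rw [h4]
  exact Nat.dvd_sub (dvd_mul_right _ _) h3

theorem pairwiseDisjoint_pair {S T : Finset ℕ} (h : Disjoint S T) :
    (({S, T} : Finset (Finset ℕ)) : Set (Finset ℕ)).PairwiseDisjoint id := by
  rw [Finset.coe_pair]
  exact (Set.pairwise_pair_of_symm (r := Function.onFun Disjoint id)).2 fun _ => h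

theorem exists_lt_of_split {x : AdmPart r n j} {B S : Finset ℕ} (hB : B ∈ x.1.parts)
    (hS : S ⊆ B) (hS0 : S.Nonempty) (hne : S ≠ B) (hmS : r * n + j ∉ S) (hd : r ∣ S.card)
    (h1 : r * n + j ∈ B → j ≤ (B \ S).card) (h2 : r * n + j ∉ B → r ∣ (B \ S).card) :
    ∃ y : AdmPart r n j, y < x := by
  have hne' : (B \ S).Nonempty := Finset.sdiff_nonempty.2 fun h => hne (hS.antisymm h)
  have hQ : ({B} : Finset (Finset ℕ)) ⊆ x.1.parts := by simpa using hB
  have hdis := pairwiseDisjoint_pair (S := S) (T := B \ S) Finset.disjoint_sdiff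
  have hU : ({S, B \ S} : Finset (Finset ℕ)).biUnion id = ({B} : Finset (Finset ℕ)).biUnion id := by
    simpa using hS
  have hp := x.1.parts_replaceParts {B} {S, B \ S} hQ hdis
    (by simp [hS0.ne_empty.symm, hne'.ne_empty.symm]) hU
  set y := x.1.replaceParts {B} {S, B \ S} hQ hdis hU
  have hmem : ∀ D, D ∈ y.parts ↔ (D ∈ x.1.parts ∧ D ≠ B) ∨ D = S ∨ D = B \ S := by
    intro D
    rw [hp]
    simp
    tauto
  refine ⟨⟨y, ?_⟩, lt_of_le_of_ne (show y ≤ x.1 from ?_) ?_⟩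
  · intro D hD
    rcases (hmem D).1 hD with hD | rfl | rfl
    · exact x.2 D hD.1
    · exact ⟨fun h => absurd h hmS, fun _ => hd⟩
    · refine ⟨fun h => h1 (Finset.mem_sdiff.1 h).1, fun h => h2 fun hm => h ?_⟩
      exact Finset.mem_sdiff.2 ⟨hm, hmS⟩
  · intro D hD
    rcases (hmem D).1 hD with hD | rfl | rfl
    · exact ⟨D, hD.1, le_rfl⟩
    · exact ⟨B, hB, hS⟩
    · exact ⟨B, hB, Finset.sdiff_subset⟩
  · intro he
    have : S ∈ x.1.parts := he ▸ (hmem S).2 (Or.inr (Or.inl rfl))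
    exact hne (x.1.eq_of_subset_of_mem_parts this hB hS)

/-- An oversized block can shed `r` elements other than `m` and stay admissible. Conversely, `n + 1`
blocks are the most possible, and a strictly finer partition would have more. -/
theorem isMin_iff (hr : 0 < r) (hj : 0 < j) (x : AdmPart r n j) :
    IsMin x ↔ HasMinimalBlocks x.1 := by
  constructor
  · intro hx B hB
    refine ⟨fun hm => ?_, fun hm => ?_⟩
    · by_contra hne
      have h1 := (x.2 B hB).1 hm
      have h2 := dvd_card_sub hj x
      rw [x.1.part_eq_of_mem hB hm] at h2
      have h3 := Nat.le_of_dvd (by omega) h2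
      have h4 : r ≤ (B.erase (r * n + j)).card := by
        rw [Finset.card_erase_of_mem hm]; omega
      obtain ⟨S, hS, hc⟩ := Finset.exists_subset_card_eq h4
      have hSB := hS.trans (Finset.erase_subset _ _)
      obtain ⟨y, hy⟩ := exists_lt_of_split hB hSB (Finset.card_pos.1 (by omega))
        (by rintro rfl; omega) (fun h => Finset.notMem_erase _ _ (hS h)) (by rw [hc])
        (fun _ => by rw [Finset.card_sdiff_of_subset hSB]; omega) (fun h => absurd hm h)
      exact hx.not_lt hy
    · by_contra hne
      have h1 := le_card_of_notMem hB hm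
      obtain ⟨S, hS, hc⟩ := Finset.exists_subset_card_eq h1
      obtain ⟨y, hy⟩ := exists_lt_of_split hB hS (Finset.card_pos.1 (by omega))
        (by rintro rfl; omega) (fun h => hm (hS h)) (by rw [hc])
        (fun h => absurd h hm) (fun h => by
          rw [Finset.card_sdiff_of_subset hS, hc]
          exact Nat.dvd_sub ((x.2 B hB).2 hm) dvd_rfl)
      exact hx.not_lt hy
  · intro h y hy
    rcases hy.eq_or_lt with rfl | hlt
    · exact le_rfl
    · have h1 := card_parts_strictAnti hlt
      have h2 := (card_parts_eq_iff hr hj x).2 h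
      have h3 := card_parts_le hr hj y
      dsimp only at h1
      omega

/-- The rank of an element of `Π_m^{r,j}` in terms of its number of blocks. -/
def level : Lat r n j → ℕ
  | ⊥ => 0
  -- Atoms have `n + 1` blocks and rank one, whence `n + 2`.
  | WithBot.some x => n + 2 - x.1.parts.card

theorem level_coe (x : AdmPart r n j) : level (x : Lat r n j) = n + 2 - x.1.parts.card := rfl

theorem level_of_covBy (hr : 0 < r) (hj : 0 < j) (x y : Lat r n j) (h : x ⋖ y) :
    level y = level x + 1 := by
  induction y using WithBot.recBotCoe with
  | bot => exact absurd h.lt not_lt_bot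
  | coe y =>
    induction x using WithBot.recBotCoe with
    | bot =>
      rw [WithBot.bot_covBy_coe, isMin_iff hr hj, ← card_parts_eq_iff hr hj] at h
      rw [level_coe, h]
      simp [level]
    | coe x =>
      rw [WithBot.coe_covBy_coe, covBy_iff] at h
      obtain ⟨B, C, h⟩ := h
      have := h.card
      have := card_parts_le hr hj x
      rw [level_coe, level_coe]
      omega

theorem rank_eq_level (hr : 0 < r) (hj : 0 < j) (x : Lat r n j) : rank x = level x :=
  rank_eq_of_covBy rfl (level_of_covBy hr hj) x

theorem isGraded_lat (hr : 0 < r) (hj : 0 < j) : IsGraded (Lat r n j) := fun x y h => by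
  rw [rank_eq_level hr hj, rank_eq_level hr hj, level_of_covBy hr hj x y h]

/-! ### Comparing pair labels -/

theorem pairLabel_lt_of_lam_lt {x y x' y' : Lat r n j} (h : lam x y < lam x' y') :
    pairLabel x y < pairLabel x' y' := Prod.Lex.toLex_lt_toLex.2 (Or.inl h)

/-- The component `-ρ` decreases along a chain, so a repeated value of `λ` counts as a descent. -/
theorem pairLabel_le_of_lam_le (hr : 0 < r) (hj : 0 < j) {x y z w : Lat r n j} (hxy : x ⋖ y)
    (h : lam y z ≤ lam x w) : pairLabel y z ≤ pairLabel x w := by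
  rcases h.lt_or_eq with h | h
  · exact (pairLabel_lt_of_lam_lt h).le
  · refine Prod.Lex.toLex_le_toLex.2 (Or.inr ⟨h, ?_⟩)
    rw [isGraded_lat hr hj x y hxy]
    push_cast
    omega

/-- The label of the edge that merges the blocks `B` and `C`, in either order. -/
def symmLabel (B C : Finset ℕ) : ℤ :=
  if blockMax B < blockMax C then mergeLabel (B, C) else mergeLabel (C, B)

theorem symmLabel_comm {B C : Finset ℕ} (h : blockMax B ≠ blockMax C) :
    symmLabel B C = symmLabel C B := by
  unfold symmLabel
  rcases lt_or_gt_of_ne h with h | h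
  · rw [if_pos h, if_neg h.not_gt]
  · rw [if_pos h, if_neg h.not_gt]

/-- Lists the possible labels in a form that `omega` can use; the comparisons of merges below are
linear arithmetic on minima and maxima. -/
theorem symmLabel_eq (B C : Finset ℕ) (h : blockMax B ≠ blockMax C) :
    (blockMax B < blockMax C ∧ blockMin C < blockMax B ∧ symmLabel B C = -(blockMax B : ℤ)) ∨
    (blockMax B < blockMax C ∧ blockMax B ≤ blockMin C ∧ symmLabel B C = blockMax C) ∨
    (blockMax C < blockMax B ∧ blockMin B < blockMax C ∧ symmLabel B C = -(blockMax C : ℤ)) ∨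
    (blockMax C < blockMax B ∧ blockMax C ≤ blockMin B ∧ symmLabel B C = blockMax B) := by
  unfold symmLabel mergeLabel
  dsimp only
  split_ifs <;> omega

theorem block_facts {x : Part r n j} {B : Finset ℕ} (hB : B ∈ x.parts) :
    0 < blockMin B ∧ blockMin B ≤ blockMax B := by
  have hn := x.nonempty_of_mem_parts hB
  have := Finset.mem_Icc.1 (x.subset hB (blockMin_mem hn))
  exact ⟨by omega, blockMin_le_blockMax hn⟩

theorem block_ne {x : Part r n j} {B C : Finset ℕ} (hB : B ∈ x.parts) (hC : C ∈ x.parts)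
    (h : B ≠ C) : blockMax B ≠ blockMax C ∧ blockMin B ≠ blockMin C ∧
      blockMax B ≠ blockMin C ∧ blockMin B ≠ blockMax C := by
  have hBn := x.nonempty_of_mem_parts hB
  have hCn := x.nonempty_of_mem_parts hC
  have key : ∀ a ∈ B, ∀ b ∈ C, a ≠ b := fun a ha b hb he => h
    (x.eq_of_mem_parts hB hC ha (he ▸ hb))
  exact ⟨key _ (blockMax_mem hBn) _ (blockMax_mem hCn), key _ (blockMin_mem hBn) _ (blockMin_mem hCn),
    key _ (blockMax_mem hBn) _ (blockMin_mem hCn), key _ (blockMin_mem hBn) _ (blockMax_mem hCn)⟩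

namespace Merges

variable {x y : Part r n j} {B C : Finset ℕ}

theorem symmLabel (h : Merges x y B C) : symmLabel B C = mergeLabel (B, C) := if_pos h.2.2.1

theorem blockMax_union (h : Merges x y B C) : blockMax (B ∪ C) = blockMax C := by
  rw [ExtendedPartition.blockMax_union (x.nonempty_of_mem_parts h.1)
    (x.nonempty_of_mem_parts h.2.1)]
  exact max_eq_right h.2.2.1.le

theorem blockMin_union (h : Merges x y B C) :
    blockMin (B ∪ C) = min (blockMin B) (blockMin C) :=
  ExtendedPartition.blockMin_union (x.nonempty_of_mem_parts h.1) (x.nonempty_of_mem_parts h.2.1)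

end Merges

/-! ### The merge of least label in an interval of partitions -/

theorem exists_merges_le_of_ne {x y : AdmPart r n j} (hxy : x ≤ y) {B C : Finset ℕ}
    (hB : B ∈ x.1.parts) (hC : C ∈ x.1.parts) (hne : B ≠ C)
    (h : y.1.part (blockMax B) = y.1.part (blockMax C)) :
    ∃ D E, ∃ z : AdmPart r n j, Merges x.1 z.1 D E ∧ z ≤ y ∧
      mergeLabel (D, E) = symmLabel B C := by
  rcases lt_or_gt_of_ne (blockMax_ne hB hC hne) with hlt | hlt
  · obtain ⟨z, hz⟩ := exists_merges hB hC hlt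
    exact ⟨B, C, z, hz, (hz.le_iff hxy).2 h, hz.symmLabel.symm⟩
  · obtain ⟨z, hz⟩ := exists_merges hC hB hlt
    exact ⟨C, B, z, hz, (hz.le_iff hxy).2 h.symm,
      by rw [symmLabel_comm hlt.ne', hz.symmLabel]⟩

/-- The merge of least label in an interval `[x, y]`. -/
structure IsFirstMerge (x y a : Part r n j) (B C : Finset ℕ) : Prop where
  merges : Merges x a B C
  le : a ≤ y
  symmLabel_le : ∀ D ∈ x.parts, ∀ E ∈ x.parts, D ≠ E → y.part (blockMax D) = y.part (blockMax E) →
    symmLabel B C ≤ symmLabel D E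

theorem exists_isFirstMerge {x y : AdmPart r n j} (h : x < y) :
    ∃ a : AdmPart r n j, ∃ B C, IsFirstMerge x.1 y.1 a.1 B C := by
  let S : Finset (Finset ℕ × Finset ℕ) := (x.1.parts ×ˢ x.1.parts).filter fun p =>
    p.1 ≠ p.2 ∧ y.1.part (blockMax p.1) = y.1.part (blockMax p.2)
  have hS : S.Nonempty := by
    obtain ⟨z, B, C, hz, hzy⟩ := exists_merges_le h
    refine ⟨(B, C), ?_⟩
    simp only [S, Finset.mem_filter, Finset.mem_product]
    exact ⟨⟨hz.1, hz.2.1⟩, hz.ne, (hz.le_iff h.le).1 hzy⟩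
  obtain ⟨⟨B, C⟩, hBC, hmin⟩ := S.exists_min_image (fun p => symmLabel p.1 p.2) hS
  simp only [S, Finset.mem_filter, Finset.mem_product] at hBC hmin
  obtain ⟨D, E, z, hz, hzy, hl⟩ := exists_merges_le_of_ne h.le hBC.1.1 hBC.1.2 hBC.2.1 hBC.2.2
  refine ⟨z, D, E, hz, hzy, fun F hF G hG hne he => ?_⟩
  rw [hz.symmLabel, hl]
  exact hmin (F, G) ⟨⟨hF, hG⟩, hne, he⟩

namespace IsFirstMerge

variable {x y a b : Part r n j} {B C D E : Finset ℕ}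

theorem part_eq (h : IsFirstMerge x y a B C) :
    y.part (blockMax B) = y.part (blockMax C) :=
  (h.merges.le_iff (h.merges.le.trans h.le)).1 h.le

/-- A negative label determines the block with the smaller maximum, a positive one the block with
the larger, so a tie shares that block. In a negative tie `C` and `E` both straddle `max B`, hence
overlap and have a smaller label. In a positive tie `B` and `D` both end before `C` begins, and
their label is smaller. -/
theorem lt_of_ne (h : IsFirstMerge x y a B C) (hb : Merges x b D E) (hby : b ≤ y)
    (hne : (D, E) ≠ (B, C)) : symmLabel B C < symmLabel D E := by
  have hxy := hb.le.trans hby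
  have p1 := h.part_eq
  have p2 := (hb.le_iff hxy).1 hby
  have hB := h.merges.1
  have hC := h.merges.2.1
  have hD := hb.1
  have hE := hb.2.1
  have l1 := h.merges.2.2.1
  have l2 := hb.2.2.1
  refine lt_of_le_of_ne (h.symmLabel_le D hD E hE hb.ne p2) fun heq => ?_
  have s1 := symmLabel_eq B C l1.ne
  have s2 := symmLabel_eq D E l2.ne
  have b1 := block_facts hB
  have b2 := block_facts hC
  by_cases hDB : D = B
  · subst hDB
    have hCE : C ≠ E := fun h => hne (by rw [h])
    have s3 := symmLabel_eq C E (blockMax_ne hC hE hCE)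
    have := h.symmLabel_le C hC E hE hCE (by rw [← p1, p2])
    have := block_ne hC hE hCE
    omega
  · have := block_ne hD hB hDB
    by_cases hEC : E = C
    · subst hEC
      have s3 := symmLabel_eq D B (blockMax_ne hD hB hDB)
      have := h.symmLabel_le D hD B hB hDB (by rw [p1, p2])
      omega
    · have := block_ne hE hC hEC
      omega

/-- If `B ∪ C` takes part in the new merge, a label that is too small would contradict the
minimality of `(B, C)` against the third block paired with `B` or `C`; equality is excluded because
the ends of distinct blocks differ. -/
theorem lt_of_merges (h : IsFirstMerge x y a B C) (hb : Merges a b D E) (hby : b ≤ y) :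
    symmLabel B C < symmLabel D E := by
  have p1 := h.part_eq
  have p2 := (hb.le_iff h.le).1 hby
  have hB := h.merges.1
  have hC := h.merges.2.1
  have l1 := h.merges.2.2.1
  have l2 := hb.2.2.1
  have s1 := symmLabel_eq B C l1.ne
  have s2 := symmLabel_eq D E l2.ne
  have b1 := block_facts hB
  have b2 := block_facts hC
  have u1 := h.merges.blockMax_union
  have u2 := h.merges.blockMin_union
  rcases h.merges.mem_parts_iff.1 hb.1 with hD | ⟨hD, hDB, hDC⟩ <;>
  rcases h.merges.mem_parts_iff.1 hb.2.1 with hE | ⟨hE, hEB, hEC⟩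
  · exact absurd (hD.trans hE.symm) hb.ne
  · rw [← hD] at u1 u2
    have s3 := symmLabel_eq C E (blockMax_ne hC hE hEC.symm)
    have := h.symmLabel_le C hC E hE hEC.symm (by rw [← u1, p2])
    have := block_ne hC hE hEC.symm
    have := block_ne hB hE hEB.symm
    have := block_facts hE
    omega
  · rw [← hE] at u1 u2
    have s3 := symmLabel_eq C D (blockMax_ne hC hD hDC.symm)
    have := h.symmLabel_le C hC D hD hDC.symm (by rw [← u1, p2])
    have s4 := symmLabel_eq B D (blockMax_ne hB hD hDB.symm)
    have := h.symmLabel_le B hB D hD hDB.symm (by rw [p1, ← u1, p2])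
    have := block_ne hC hD hDC.symm
    have := block_ne hB hD hDB.symm
    have := block_facts hD
    omega
  · have := h.symmLabel_le D hD E hE hb.ne p2
    have := block_ne hC hD hDC.symm
    have := block_ne hB hD hDB.symm
    have := block_ne hC hE hEC.symm
    have := block_ne hB hE hEB.symm
    have := block_facts hD
    have := block_facts hE
    omega

/-- If the merge of `D` and `E` leaves `B` and `C` intact, they can be merged next. If it uses one
of them, the other one is merged with `D ∪ E`. -/
theorem exists_le_of_ne {x y a b : AdmPart r n j} (h : IsFirstMerge x.1 y.1 a.1 B C)
    (hb : Merges x.1 b.1 D E) (hby : b ≤ y) (hne : (D, E) ≠ (B, C)) :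
    ∃ F G, ∃ c : AdmPart r n j, Merges b.1 c.1 F G ∧ c ≤ y ∧
      mergeLabel (F, G) ≤ symmLabel D E := by
  have hlt := h.lt_of_ne hb hby hne
  have p1 := h.part_eq
  have p2 := (hb.le_iff (hb.le.trans hby)).1 hby
  have hB := h.merges.1
  have hC := h.merges.2.1
  have hD := hb.1
  have hE := hb.2.1
  have l1 := h.merges.2.2.1
  have l2 := hb.2.2.1
  have hBC := h.merges.ne
  have hU := hb.union_mem
  have s1 := symmLabel_eq B C l1.ne
  have s2 := symmLabel_eq D E l2.ne
  have b1 := block_facts hB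
  have b2 := block_facts hC
  have b3 := block_facts hD
  have b4 := block_facts hE
  have u1 := hb.blockMax_union
  have u2 := hb.blockMin_union
  have old : ∀ F ∈ x.1.parts, F ≠ D → F ≠ E → F ∈ b.1.parts ∧ F ≠ D ∪ E := fun F hF h1 h2 =>
    ⟨hb.mem_parts_iff.2 (Or.inr ⟨hF, h1, h2⟩), fun he => hb.union_notMem (he ▸ hF)⟩
  suffices hs : ∃ F G, F ∈ b.1.parts ∧ G ∈ b.1.parts ∧ F ≠ G ∧
      y.1.part (blockMax F) = y.1.part (blockMax G) ∧ symmLabel F G ≤ symmLabel D E by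
    obtain ⟨F, G, hF, hG, hne, he, hle⟩ := hs
    obtain ⟨F', G', c, h1, h2, h3⟩ := exists_merges_le_of_ne hby hF hG hne he
    exact ⟨F', G', c, h1, h2, h3.trans_le hle⟩
  by_cases hDB : D = B
  · subst hDB
    have hEC : C ≠ E := fun h => hne (by rw [h])
    obtain ⟨m1, m2⟩ := old C hC hBC.symm hEC
    refine ⟨C, D ∪ E, m1, hU, m2, by rw [u1, ← p1, p2], ?_⟩
    have := block_ne hC hE hEC
    have s3 := symmLabel_eq C (D ∪ E) (by omega)
    omega
  by_cases hEB : E = B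
  · subst hEB
    have hDC : C ≠ D := by rintro rfl; omega
    obtain ⟨m1, m2⟩ := old C hC hDC hBC.symm
    refine ⟨C, D ∪ E, m1, hU, m2, by rw [u1, ← p1], ?_⟩
    have := block_ne hC hD hDC
    have s3 := symmLabel_eq C (D ∪ E) (by omega)
    omega
  obtain ⟨m1, m2⟩ := old B hB (Ne.symm hDB) (Ne.symm hEB)
  have n1 := block_ne hB hD (Ne.symm hDB)
  have n2 := block_ne hB hE (Ne.symm hEB)
  by_cases hDC : D = C
  · subst hDC
    refine ⟨B, D ∪ E, m1, hU, m2, by rw [u1, p1, p2], ?_⟩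
    have s3 := symmLabel_eq B (D ∪ E) (by omega)
    omega
  by_cases hEC : E = C
  · subst hEC
    refine ⟨B, D ∪ E, m1, hU, m2, by rw [u1, p1], ?_⟩
    have s3 := symmLabel_eq B (D ∪ E) (by omega)
    omega
  · obtain ⟨m3, m4⟩ := old C hC (Ne.symm hDC) (Ne.symm hEC)
    exact ⟨B, C, m1, m3, hBC, p1, hlt.le⟩

end IsFirstMerge

/-! ### The separated atom below a partition -/

/-- Distinct blocks of `x` in the same block of `y` lie one after the other. -/
def IsSeparated (x y : Part r n j) : Prop :=
  ∀ B ∈ x.parts, ∀ C ∈ x.parts, blockMax B < blockMax C →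
    y.part (blockMax B) = y.part (blockMax C) → blockMax B ≤ blockMin C

theorem part_eq_of_mem_part {x y : Part r n j} (hxy : x ≤ y) {B : Finset ℕ} (hB : B ∈ x.parts)
    {a : ℕ} (ha : a ∈ B) : y.part (blockMax B) = y.part a :=
  Finpartition.part_eq_part_of_le hxy hB (blockMax_mem ⟨a, ha⟩) ha

/-- A block of `x` is an interval of its block of `y`: another block of `x` through `b` would end
before `B` begins or begin after `B` ends. -/
theorem IsSeparated.mem_of_between {x y : Part r n j} (h : IsSeparated x y) (hxy : x ≤ y)
    {B : Finset ℕ} (hB : B ∈ x.parts) {a b c : ℕ} (ha : a ∈ B) (hc : c ∈ B)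
    (hb : b ∈ Finset.Icc 1 (r * n + j)) (hab : a ≤ b) (hbc : b ≤ c)
    (hy : y.part b = y.part a) : b ∈ B := by
  by_contra hbB
  have hD := x.part_mem.2 hb
  have hbD := x.mem_part_self.2 hb
  have hne : x.part b ≠ B := fun h => hbB (h ▸ hbD)
  have e1 := part_eq_of_mem_part hxy hB ha
  have e2 := part_eq_of_mem_part hxy hD hbD
  have f1 := le_blockMax hbD
  have f2 := blockMin_le hbD
  have f3 := le_blockMax hc
  have f4 := blockMin_le ha
  rcases lt_or_gt_of_ne (blockMax_ne hD hB hne) with hlt | hlt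
  · have := h _ hD _ hB hlt (by rw [e1, e2, hy])
    exact hbB ((show b = a by omega) ▸ ha)
  · have := h _ hB _ hD hlt (by rw [e1, e2, hy])
    exact hbB ((show b = c by omega) ▸ hc)

/-- Otherwise the `x`-block of `e`, which contains all of its `y`-block from `e` to `m`, would
contain the `x'`-block of `e` and the disjoint `x'`-block of `m`, hence more than `j` elements. -/
theorem IsSeparated.not_mem_max {x x' y : Part r n j} (hj : 0 < j) (hx : HasMinimalBlocks x)
    (hx' : HasMinimalBlocks x') (hxy : x ≤ y) (hxy' : x' ≤ y) (h : IsSeparated x y)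
    (h' : IsSeparated x' y) {e : ℕ} (he : e ∈ Finset.Icc 1 (r * n + j))
    (hm : r * n + j ∈ x.part e) (hmin : ∀ a ∈ x'.part e, e ≤ a) : r * n + j ∈ x'.part e := by
  by_contra hm'
  have hmI := max_mem_Icc (r := r) (n := n) hj
  have hB := x.part_mem.2 he
  have heB := x.mem_part_self.2 he
  have hB' := x'.part_mem.2 he
  have heB' := x'.mem_part_self.2 he
  have hU := x'.part_mem.2 hmI
  have hmU := x'.mem_part_self.2 hmI
  have hymU : y.part (r * n + j) = y.part e := Finpartition.part_eq_part_of_le hxy hB hm heB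
  have hle : ∀ a ∈ Finset.Icc 1 (r * n + j), a ≤ r * n + j := fun a ha => (Finset.mem_Icc.1 ha).2
  have hUmax : blockMax (x'.part (r * n + j)) = r * n + j :=
    blockMax_eq hmU fun a ha => hle a (x'.subset hU ha)
  have hlt : blockMax (x'.part e) < blockMax (x'.part (r * n + j)) := by
    rw [hUmax]
    have := blockMax_mem ⟨e, heB'⟩
    exact lt_of_le_of_ne (hle _ (x'.subset hB' this)) (ne_of_mem_of_not_mem this hm')
  have hsep := h' _ hB' _ hU hlt (by
    rw [part_eq_of_mem_part hxy' hB' heB', hUmax, hymU])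
  have sub1 : x'.part e ⊆ x.part e := fun a ha =>
    h.mem_of_between hxy hB heB hm (x'.subset hB' ha) (hmin a ha) (hle _ (x'.subset hB' ha))
      (Finpartition.part_eq_part_of_le hxy' hB' ha heB')
  have sub2 : x'.part (r * n + j) ⊆ x.part e := fun a ha =>
    h.mem_of_between hxy hB heB hm (x'.subset hU ha)
      ((hmin _ (blockMax_mem ⟨e, heB'⟩)).trans (hsep.trans (blockMin_le ha)))
      (hle _ (x'.subset hU ha))
      ((Finpartition.part_eq_part_of_le hxy' hU ha hmU).trans hymU)
  have hd : Disjoint (x'.part e) (x'.part (r * n + j)) :=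
    x'.disjoint hB' hU fun h => hm' (h ▸ hmU)
  have hc := Finset.card_le_card (Finset.union_subset sub1 sub2)
  rw [Finset.card_union_of_disjoint hd, (hx _ hB).1 hm, (hx' _ hU).1 hmU] at hc
  have := Finset.card_pos.2 ⟨e, heB'⟩
  omega

/-- By induction on `e`, its two blocks agree. If `e` is not the minimum of both, a smaller element
decides. Otherwise both are intervals of the same `y`-block starting at `e`, of equal size by
`not_mem_max`; the one that ends first is contained in the other. -/
theorem IsSeparated.unique {x x' y : Part r n j} (hj : 0 < j) (hx : HasMinimalBlocks x)
    (hx' : HasMinimalBlocks x') (hxy : x ≤ y) (hxy' : x' ≤ y) (h : IsSeparated x y)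
    (h' : IsSeparated x' y) : x = x' := by
  suffices hp : ∀ e ∈ Finset.Icc 1 (r * n + j), x.part e = x'.part e from
    Finpartition.eq_of_part fun a ha b hb => by rw [hp a ha, hp b hb]
  intro e
  induction e using Nat.strong_induction_on with
  | _ e ih =>
  intro he
  by_contra hne
  have hB := x.part_mem.2 he
  have heB := x.mem_part_self.2 he
  have hB' := x'.part_mem.2 he
  have heB' := x'.mem_part_self.2 he
  have hmin : ∀ a ∈ x.part e, e ≤ a := by
    intro a ha
    by_contra! hlt
    have haI := x.subset hB ha
    have h1 := ih a hlt haI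
    rw [x.part_eq_of_mem hB ha] at h1
    refine hne (x'.part_eq_of_mem ?_ heB).symm
    rw [h1]
    exact x'.part_mem.2 haI
  have hmin' : ∀ a ∈ x'.part e, e ≤ a := by
    intro a ha
    by_contra! hlt
    have haI := x'.subset hB' ha
    have h1 := ih a hlt haI
    rw [x'.part_eq_of_mem hB' ha] at h1
    refine hne (x.part_eq_of_mem ?_ heB')
    rw [← h1]
    exact x.part_mem.2 haI
  have hc : (x.part e).card = (x'.part e).card := by
    by_cases hm : r * n + j ∈ x.part e
    · rw [(hx _ hB).1 hm, (hx' _ hB').1 (h.not_mem_max hj hx hx' hxy hxy' h' he hm hmin')]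
    · have hm' : r * n + j ∉ x'.part e := fun hm' =>
        hm (h'.not_mem_max hj hx' hx hxy' hxy h he hm' hmin)
      rw [(hx _ hB).2 hm, (hx' _ hB').2 hm']
  rcases le_total (blockMax (x.part e)) (blockMax (x'.part e)) with hle | hle
  · refine hne (Finset.eq_of_subset_of_card_le (fun a ha => ?_) hc.ge)
    exact h'.mem_of_between hxy' hB' heB' (blockMax_mem ⟨e, heB'⟩) (x.subset hB ha) (hmin a ha)
      ((le_blockMax ha).trans hle) (Finpartition.part_eq_part_of_le hxy hB ha heB)
  · refine hne (Finset.eq_of_subset_of_card_le (fun a ha => ?_) hc.le).symm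
    exact h.mem_of_between hxy hB heB (blockMax_mem ⟨e, heB⟩) (x'.subset hB' ha) (hmin' a ha)
      ((le_blockMax ha).trans hle) (Finpartition.part_eq_part_of_le hxy' hB' ha heB')

/-! ### Words -/

theorem sort_union {A B : Finset ℕ} (h : ∀ a ∈ A, ∀ b ∈ B, a < b) :
    (A ∪ B).sort (· ≤ ·) = A.sort (· ≤ ·) ++ B.sort (· ≤ ·) := by
  refine List.Perm.eq_of_pairwise' (r := (· ≤ ·)) (Finset.pairwise_sort _ _) ?_ ?_
  · rw [List.pairwise_append]
    exact ⟨Finset.pairwise_sort _ _, Finset.pairwise_sort _ _, fun a ha b hb =>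
      (h a (by simpa using ha) b (by simpa using hb)).le⟩
  · rw [List.perm_ext_iff_of_nodup (Finset.sort_nodup _ _)]
    · simp
    · rw [List.nodup_append]
      exact ⟨Finset.sort_nodup _ _, Finset.sort_nodup _ _, fun a ha b hb =>
        (h a (by simpa using ha) b (by simpa using hb)).ne⟩

theorem append_lt_append_left (P : List ℕ) {L L' : List ℕ}
    (h : L < L') : P ++ L < P ++ L' := by
  induction P with
  | nil => exact h
  | cons a P ih => exact List.cons_lt_cons_iff.2 (Or.inr ⟨rfl, ih⟩)

/-- The words first differ where the left one has `s`. The element `f` ensures that the right one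
still has a letter of `F` there, necessarily larger than `s`, so `L` and `L'` are irrelevant. -/
theorem sort_append_lt {S F : Finset ℕ} {s f : ℕ} (hs : s ∈ S) (hsF : s ∉ F)
    (h : ∀ e < s, e ∈ S ↔ e ∈ F) (hf : f ∈ F) (hsf : s < f) (L L' : List ℕ) :
    S.sort (· ≤ ·) ++ L < F.sort (· ≤ ·) ++ L' := by
  have h1 : S = F.filter (· < s) ∪ ({s} ∪ S.filter (s < ·)) := by
    ext e
    have := h e
    simp only [Finset.mem_union, Finset.mem_filter, Finset.mem_singleton]
    rcases lt_trichotomy e s with h | rfl | h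
    · have := this h; grind
    · simp [hs]
    · grind
  have h2 : F = F.filter (· < s) ∪ F.filter (s < ·) := by
    ext e
    simp only [Finset.mem_union, Finset.mem_filter]
    rcases lt_trichotomy e s with h | rfl | h <;> grind
  obtain ⟨a, l, hal⟩ : ∃ a l, (F.filter (s < ·)).sort (· ≤ ·) = a :: l := by
    refine List.exists_cons_of_ne_nil fun h => ?_
    have : f ∈ (F.filter (s < ·)).sort (· ≤ ·) := by simp [hf, hsf]
    rw [h] at this
    simp at this
  have ha : s < a := by
    have : a ∈ (F.filter (s < ·)).sort (· ≤ ·) := by simp [hal]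
    simp only [Finset.mem_sort, Finset.mem_filter] at this
    exact this.2
  rw [h1, sort_union, sort_union]
  · conv_rhs => rw [h2, sort_union (by simp only [Finset.mem_filter]; omega)]
    simp only [List.append_assoc, hal]
    refine append_lt_append_left _ ?_
    simp only [Finset.sort_singleton, List.cons_append, List.nil_append]
    exact List.cons_lt_cons_iff.2 (Or.inl ha)
  · simp
  · simp only [Finset.mem_union, Finset.mem_filter, Finset.mem_singleton]
    omega

/-- The concatenation of the sorted sets `p i`, `i ∈ I`, in the order of the indices. -/
def concatSorted (I : Finset ℕ) (p : ℕ → Finset ℕ) : List ℕ :=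
  (I.sort (· ≤ ·)).flatMap fun i => (p i).sort (· ≤ ·)

theorem concatSorted_union {I J : Finset ℕ} (h : ∀ a ∈ I, ∀ b ∈ J, a < b) (p : ℕ → Finset ℕ) :
    concatSorted (I ∪ J) p = concatSorted I p ++ concatSorted J p := by
  rw [concatSorted, sort_union h, List.flatMap_append]
  rfl

theorem concatSorted_congr {I : Finset ℕ} {p q : ℕ → Finset ℕ} (h : ∀ i ∈ I, p i = q i) :
    concatSorted I p = concatSorted I q := by
  unfold concatSorted
  rw [List.flatMap_def, List.flatMap_def]
  congr 1
  refine List.map_congr_left fun i hi => ?_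
  rw [h i (by simpa using hi)]

theorem concatSorted_eq_cons {I : Finset ℕ} {i : ℕ} (hi : i ∈ I) (p : ℕ → Finset ℕ) :
    concatSorted I p = concatSorted (I.filter (· < i)) p ++ ((p i).sort (· ≤ ·) ++
      concatSorted (I.filter (i < ·)) p) := by
  have h1 : I = I.filter (· < i) ∪ ({i} ∪ I.filter (i < ·)) := by
    ext e
    simp only [Finset.mem_union, Finset.mem_filter, Finset.mem_singleton]
    rcases lt_trichotomy e i with h | rfl | h <;> grind
  conv_lhs => rw [h1, concatSorted_union (by
    simp only [Finset.mem_union, Finset.mem_filter, Finset.mem_singleton]; omega),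
    concatSorted_union (by simp)]
  simp [concatSorted]

theorem word_eq (x : Part r n j) : word x = concatSorted (x.parts.image blockMin) x.part := rfl

theorem exists_initial_subset (U : Finset ℕ) (k : ℕ) (hk : k ≤ U.card) :
    ∃ S ⊆ U, S.card = k ∧ ∀ s ∈ S, ∀ t ∈ U \ S, s < t := by
  induction k with
  | zero => exact ⟨∅, by simp, by simp, by simp⟩
  | succ k ih =>
    obtain ⟨S, hS, hc, h⟩ := ih (by omega)
    have hne : (U \ S).Nonempty := by
      rw [← Finset.card_pos, Finset.card_sdiff_of_subset hS]; omega
    have hm := blockMin_mem hne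
    rw [Finset.mem_sdiff] at hm
    refine ⟨insert (blockMin (U \ S)) S, Finset.insert_subset hm.1 hS, ?_, ?_⟩
    · rw [Finset.card_insert_of_notMem hm.2, hc]
    · intro s hs t ht
      rw [Finset.mem_sdiff, Finset.mem_insert, not_or] at ht
      have ht' : t ∈ U \ S := Finset.mem_sdiff.2 ⟨ht.1, ht.2.2⟩
      rcases Finset.mem_insert.1 hs with rfl | hs
      · exact lt_of_le_of_ne (blockMin_le ht') (Ne.symm ht.2.1)
      · exact h s hs t ht'

theorem mem_image_blockMin {x : Part r n j} {i : ℕ} (h : i ∈ x.parts.image blockMin) :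
    x.part i ∈ x.parts ∧ blockMin (x.part i) = i ∧ i ∈ x.part i := by
  obtain ⟨D, hD, rfl⟩ := Finset.mem_image.1 h
  have hm := blockMin_mem (x.nonempty_of_mem_parts hD)
  rw [x.part_eq_of_mem hD hm]
  exact ⟨hD, rfl, hm⟩

theorem part_blockMin {x : Part r n j} {B : Finset ℕ} (hB : B ∈ x.parts) :
    x.part (blockMin B) = B :=
  x.part_eq_of_mem hB (blockMin_mem (x.nonempty_of_mem_parts hB))

/-- Exchanging elements between two overlapping blocks, so that they lie one after the other, makes
the word of the partition smaller. -/
theorem word_lt_of_exchange {x x' : Part r n j} {B C S : Finset ℕ} (hB : B ∈ x.parts)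
    (hC : C ∈ x.parts) (hlt : blockMax B < blockMax C) (hov : blockMin C < blockMax B)
    (hS : S ⊆ B ∪ C) (hcard : S.card = B.card) (hST : ∀ s ∈ S, ∀ t ∈ (B ∪ C) \ S, s < t)
    (hp : ∀ D, D ∈ x'.parts ↔ (D ∈ x.parts ∧ D ≠ B ∧ D ≠ C) ∨ D = S ∨ D = (B ∪ C) \ S) :
    word x' < word x := by
  have hBne := x.nonempty_of_mem_parts hB
  have hCne := x.nonempty_of_mem_parts hC
  have hBC : B ≠ C := by rintro rfl; exact hlt.false
  have hdis : ∀ e, e ∈ B → e ∉ C := fun e h h' => hBC (x.eq_of_mem_parts hB hC h h')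
  set U := B ∪ C with hU
  have hSne : S.Nonempty := by
    rw [← Finset.card_pos, hcard]; exact Finset.card_pos.2 hBne
  have hUne : U.Nonempty := hBne.mono Finset.subset_union_left
  have hUmax : blockMax U = blockMax C := by
    rw [hU, blockMax_union hBne hCne]; exact max_eq_right hlt.le
  have hSp : S ∈ x'.parts := (hp S).2 (Or.inr (Or.inl rfl))
  have hTp : U \ S ∈ x'.parts := (hp _).2 (Or.inr (Or.inr rfl))
  have hTne := x'.nonempty_of_mem_parts hTp
  have hCmaxU : blockMax C ∈ U := Finset.mem_union_right _ (blockMax_mem hCne)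
  have hCmaxS : blockMax C ∉ S := fun h => by
    obtain ⟨t, ht⟩ := hTne
    have h1 := hST _ h t ht
    have h2 := le_blockMax (Finset.mem_sdiff.1 ht).1
    omega
  have hSB : S ≠ B := by
    rintro rfl
    have h1 : blockMin C ∈ U \ S := Finset.mem_sdiff.2
      ⟨Finset.mem_union_right _ (blockMin_mem hCne), fun h => hdis _ h (blockMin_mem hCne)⟩
    have := hST _ (blockMax_mem hBne) _ h1
    omega
  have hμS : blockMin U ∈ S := by
    by_contra h
    obtain ⟨s, hs⟩ := hSne
    have h1 := hST s hs _ (Finset.mem_sdiff.2 ⟨blockMin_mem hUne, h⟩)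
    have h2 := blockMin_le (hS hs)
    omega
  have hSmin : blockMin S = blockMin U := blockMin_eq hμS fun a ha => blockMin_le (hS ha)
  obtain ⟨F, hF, hFp, hμF⟩ : ∃ F, (F = B ∨ F = C) ∧ F ∈ x.parts ∧ blockMin F = blockMin U := by
    rw [hU, blockMin_union hBne hCne]
    rcases min_choice (blockMin B) (blockMin C) with h | h <;> rw [h]
    · exact ⟨B, Or.inl rfl, hB, rfl⟩
    · exact ⟨C, Or.inr rfl, hC, rfl⟩
  have hFU : F ⊆ U := by
    rcases hF with rfl | rfl
    · exact Finset.subset_union_left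
    · exact Finset.subset_union_right
  -- Blocks with minimum below `min U` are common to both partitions, so the words agree until `S`
  -- faces `F`, the block of `x` that contains `min U`.
  have hpre : concatSorted ((x'.parts.image blockMin).filter (· < blockMin U)) x'.part =
      concatSorted ((x.parts.image blockMin).filter (· < blockMin U)) x.part := by
    have key : ∀ D, blockMin D < blockMin U → (D ∈ x'.parts ↔ D ∈ x.parts) := by
      intro D hD
      rw [hp]
      constructor
      · rintro (h | rfl | rfl)
        · exact h.1
        · omega
        · have := blockMin_le (Finset.mem_sdiff.1 (blockMin_mem hTne)).1
          omega
      · intro h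
        refine Or.inl ⟨h, ?_, ?_⟩ <;> rintro rfl
        · have : blockMin U ≤ blockMin D := blockMin_le (Finset.mem_union_left C (blockMin_mem hBne))
          omega
        · have : blockMin U ≤ blockMin D := blockMin_le (Finset.mem_union_right B (blockMin_mem hCne))
          omega
    have hI : (x'.parts.image blockMin).filter (· < blockMin U) =
        (x.parts.image blockMin).filter (· < blockMin U) := by
      ext i
      simp only [Finset.mem_filter, Finset.mem_image]
      constructor
      · rintro ⟨⟨D, hD, rfl⟩, hlt⟩
        exact ⟨⟨D, (key D hlt).1 hD, rfl⟩, hlt⟩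
      · rintro ⟨⟨D, hD, rfl⟩, hlt⟩
        exact ⟨⟨D, (key D hlt).2 hD, rfl⟩, hlt⟩
    rw [hI]
    refine concatSorted_congr fun i hi => ?_
    rw [Finset.mem_filter] at hi
    obtain ⟨h1, h2, h3⟩ := mem_image_blockMin hi.1
    exact x'.part_eq_of_mem ((key _ (by omega)).2 h1) h3
  have hμ' : blockMin U ∈ x'.parts.image blockMin := Finset.mem_image.2 ⟨S, hSp, hSmin⟩
  have hμ : blockMin U ∈ x.parts.image blockMin := Finset.mem_image.2 ⟨F, hFp, hμF⟩
  rw [word_eq, word_eq, concatSorted_eq_cons hμ', concatSorted_eq_cons hμ, hpre, x'.part_eq_of_mem hSp hμS,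
    x.part_eq_of_mem hFp (hμF ▸ blockMin_mem (x.nonempty_of_mem_parts hFp))]
  refine append_lt_append_left _ ?_
  -- If `S ⊆ F`, then `F = C` and `S` is a common prefix; what follows is the next block of `x'`
  -- against the rest of `C`. Otherwise the least element of `S \ F` decides.
  by_cases hSF : S ⊆ F
  · obtain rfl : F = C := by
      refine hF.resolve_left ?_
      rintro rfl
      exact hSB (Finset.eq_of_subset_of_card_le hSF hcard.ge)
    have hsp : F = S ∪ F \ S := by simp [hSF]
    have hR : ∀ s ∈ S, ∀ t ∈ F \ S, s < t := fun s hs t ht =>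
      hST s hs t (Finset.sdiff_subset_sdiff hFU le_rfl ht)
    conv_rhs => rw [hsp, sort_union hR, List.append_assoc]
    refine append_lt_append_left _ ?_
    have hmR : blockMax F ∈ F \ S := Finset.mem_sdiff.2 ⟨blockMax_mem hCne, hCmaxS⟩
    have hRmin := blockMin_mem ⟨_, hmR⟩
    set I := (x'.parts.image blockMin).filter (blockMin U < ·) with hI
    have hTI : blockMin (U \ S) ∈ I := Finset.mem_filter.2 ⟨Finset.mem_image_of_mem _ hTp,
      hST _ hμS _ (blockMin_mem hTne)⟩
    have hν := blockMin_mem ⟨_, hTI⟩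
    have hνle := blockMin_le hTI
    have hTle : blockMin (U \ S) ≤ blockMin (F \ S) :=
      blockMin_le (Finset.sdiff_subset_sdiff hFU le_rfl hRmin)
    obtain ⟨hN1, hN2, hN3⟩ := mem_image_blockMin (Finset.mem_filter.1 hν).1
    have hemp : I.filter (· < blockMin I) = ∅ := by
      rw [Finset.filter_eq_empty_iff]
      exact fun i hi => (blockMin_le hi).not_gt
    rw [concatSorted_eq_cons hν, hemp]
    simp only [concatSorted, Finset.sort_empty, List.flatMap_nil, List.nil_append]
    rcases lt_or_eq_of_le (hνle.trans hTle) with hlt' | heq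
    · refine sort_append_lt hN3 (fun h => ?_) (fun e he => ?_) hRmin hlt' _ _
      · have := blockMin_le h; omega
      · constructor
        · intro h; have := blockMin_le h; omega
        · intro h; have := blockMin_le h; omega
    -- Now the next block of `x'` is `U \ S` itself. It contains all of `B`, and it first differs
    -- from `C \ S` at `min B`.
    · have hT : x'.part (blockMin I) = U \ S := by
        rw [show blockMin I = blockMin (U \ S) by omega, part_blockMin hTp]
      have hBS : ∀ e ∈ B, e ∈ U \ S := fun e he =>
        Finset.mem_sdiff.2 ⟨Finset.mem_union_left _ he, fun h => hdis e he (hSF h)⟩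
      rw [hT]
      refine sort_append_lt (s := blockMin B) (f := blockMax F) (hBS _ (blockMin_mem hBne))
        (fun h => hdis _ (blockMin_mem hBne) (Finset.mem_sdiff.1 h).1) (fun e he => ?_) hmR
        ((blockMin_le_blockMax hBne).trans_lt hlt) _ _
      simp only [Finset.mem_sdiff, hU, Finset.mem_union]
      have : e ∉ B := fun h => by have := blockMin_le h; omega
      tauto
  · have hne : (S \ F).Nonempty := Finset.sdiff_nonempty.2 hSF
    have hs := blockMin_mem hne
    have hs' := Finset.mem_sdiff.1 hs
    -- If `F = B`, some element of `B` lies outside `S` because the sizes agree; if `F = C`, its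
    -- maximum serves.
    obtain ⟨f, hf, hsf⟩ : ∃ f ∈ F, blockMin (S \ F) < f := by
      rcases hF with rfl | rfl
      · obtain ⟨f, hf, hfS⟩ : ∃ f ∈ F, f ∉ S := by
          by_contra! hcon
          exact hSB (Finset.eq_of_subset_of_card_le hcon hcard.le).symm
        exact ⟨f, hf, hST _ hs'.1 _ (Finset.mem_sdiff.2 ⟨hFU hf, hfS⟩)⟩
      · exact ⟨_, blockMax_mem hCne, hST _ hs'.1 _ (Finset.mem_sdiff.2 ⟨hCmaxU, hCmaxS⟩)⟩
    refine sort_append_lt hs'.1 hs'.2 (fun e he => ⟨fun h => ?_, fun h => ?_⟩) hf hsf _ _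
    · by_contra hcon
      have := blockMin_le (Finset.mem_sdiff.2 ⟨h, hcon⟩)
      omega
    · by_contra hcon
      have := hST _ hs'.1 _ (Finset.mem_sdiff.2 ⟨hFU h, hcon⟩)
      omega

/-- Regrouping an overlapping pair into its `|B|` smallest elements and the rest preserves
minimality: `m` is not in `B`, as `max B < max C`, and if it is in `C` then, being largest, it falls
in the second part. -/
theorem exists_word_lt (hr : 0 < r) (hj : 0 < j) {x y : AdmPart r n j} (hx : IsMin x)
    (hxy : x ≤ y) (hs : ¬ IsSeparated x.1 y.1) :
    ∃ x' : AdmPart r n j, IsMin x' ∧ x' ≤ y ∧ word x'.1 < word x.1 := by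
  unfold IsSeparated at hs
  push Not at hs
  obtain ⟨B, hB, C, hC, hlt, hy, hov⟩ := hs
  rw [isMin_iff hr hj] at hx
  have hBC : B ≠ C := by rintro rfl; exact hlt.false
  have hd : Disjoint B C := x.1.disjoint hB hC hBC
  obtain ⟨S, hS, hcard, hST⟩ := exists_initial_subset (B ∪ C) B.card
    (Finset.card_le_card Finset.subset_union_left)
  have hBpos := Finset.card_pos.2 (x.1.nonempty_of_mem_parts hB)
  have hCpos := Finset.card_pos.2 (x.1.nonempty_of_mem_parts hC)
  have hSne : S.Nonempty := Finset.card_pos.1 (by omega)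
  have hTcard : ((B ∪ C) \ S).card = C.card := by
    rw [Finset.card_sdiff_of_subset hS, Finset.card_union_of_disjoint hd]; omega
  have hTne : ((B ∪ C) \ S).Nonempty := Finset.card_pos.1 (by omega)
  have hQ : ({B, C} : Finset (Finset ℕ)) ⊆ x.1.parts := by
    simp [Finset.insert_subset_iff, hB, hC]
  have hdis := pairwiseDisjoint_pair (S := S) (T := (B ∪ C) \ S) Finset.disjoint_sdiff
  have hU : ({S, (B ∪ C) \ S} : Finset (Finset ℕ)).biUnion id =
      ({B, C} : Finset (Finset ℕ)).biUnion id := by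
    simpa using hS
  have hp := x.1.parts_replaceParts {B, C} {S, (B ∪ C) \ S} hQ hdis
    (by simp [hSne.ne_empty.symm, hTne.ne_empty.symm]) hU
  set x' := x.1.replaceParts {B, C} {S, (B ∪ C) \ S} hQ hdis hU
  have hmem : ∀ D, D ∈ x'.parts ↔
      (D ∈ x.1.parts ∧ D ≠ B ∧ D ≠ C) ∨ D = S ∨ D = (B ∪ C) \ S := by
    intro D
    rw [hp]
    simp
    tauto
  have hle : ∀ a ∈ B ∪ C, a ≤ r * n + j := fun a ha => by
    rcases Finset.mem_union.1 ha with h | h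
    · exact (Finset.mem_Icc.1 (x.1.subset hB h)).2
    · exact (Finset.mem_Icc.1 (x.1.subset hC h)).2
  have hmB : r * n + j ∉ B := fun h => by
    have h1 := le_blockMax h
    have h2 := hle _ (Finset.mem_union_right B (blockMax_mem (x.1.nonempty_of_mem_parts hC)))
    omega
  have hmS : r * n + j ∉ S := fun h => by
    obtain ⟨t, ht⟩ := hTne
    have h1 := hST _ h t ht
    have h2 := hle _ (Finset.mem_sdiff.1 ht).1
    omega
  have hmin : HasMinimalBlocks x' := by
    intro D hD
    rcases (hmem D).1 hD with hD | rfl | rfl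
    · exact hx D hD.1
    · exact ⟨fun h => absurd h hmS, fun _ => hcard.trans ((hx B hB).2 hmB)⟩
    · rw [hTcard, Finset.mem_sdiff, Finset.mem_union]
      have := hx C hC
      tauto
  have hadm : Admissible r n j x' := fun D hD =>
    ⟨fun h => ((hmin D hD).1 h).ge, fun h => ((hmin D hD).2 h).symm.dvd⟩
  obtain ⟨z, hz⟩ := exists_merges hB hC hlt
  obtain ⟨Y, hY, hUY⟩ := (hz.le_iff hxy).2 hy hz.union_mem
  refine ⟨⟨x', hadm⟩, (isMin_iff hr hj _).2 hmin, fun D hD => ?_,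
    word_lt_of_exchange hB hC hlt hov hS hcard hST hmem⟩
  rcases (hmem D).1 hD with hD | rfl | rfl
  · exact hxy hD.1
  · exact ⟨Y, hY, hS.trans hUY⟩
  · exact ⟨Y, hY, Finset.sdiff_subset.trans hUY⟩

/-- An atom with minimal word is separated by `exists_word_lt`. Any other atom is then not
separated, so some atom has a word strictly below its own; strictness thus needs no injectivity of
`word`. -/
theorem exists_isMin_separated (hr : 0 < r) (hj : 0 < j) (y : AdmPart r n j) :
    ∃ a : AdmPart r n j, IsMin a ∧ a ≤ y ∧ IsSeparated a.1 y.1 ∧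
      ∀ b : AdmPart r n j, IsMin b → b ≤ y → b ≠ a →
        word a.1 < word b.1 ∧ ¬ IsSeparated b.1 y.1 := by
  have hfin : {b : AdmPart r n j | IsMin b ∧ b ≤ y}.Finite := Set.toFinite _
  have hne : {b : AdmPart r n j | IsMin b ∧ b ≤ y}.Nonempty := by
    obtain ⟨b, hby, hb⟩ := Finite.exists_le_minimal (p := fun _ : AdmPart r n j => True)
      (a := y) trivial
    exact ⟨b, minimal_true.1 hb, hby⟩
  obtain ⟨a, ha, hmin⟩ := hfin.exists_minimalFor (fun b => word b.1) _ hne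
  have hsep : IsSeparated a.1 y.1 := by
    by_contra hs
    obtain ⟨x', h1, h2, h3⟩ := exists_word_lt hr hj ha.1 ha.2 hs
    exact (hmin ⟨h1, h2⟩ h3.le).not_gt h3
  have huniq : ∀ b : AdmPart r n j, IsMin b → b ≤ y → b ≠ a → ¬ IsSeparated b.1 y.1 :=
    fun b hb hby hne hs => hne <| Subtype.ext <| hs.unique hj ((isMin_iff hr hj b).1 hb)
      ((isMin_iff hr hj a).1 ha.1) hby ha.2 hsep
  refine ⟨a, ha.1, ha.2, hsep, fun b hb hby hne => ⟨?_, huniq b hb hby hne⟩⟩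
  obtain ⟨x', h1, h2, h3⟩ := exists_word_lt hr hj hb hby (huniq b hb hby hne)
  refine lt_of_le_of_lt ?_ h3
  exact (le_total (word a.1) (word x'.1)).elim id fun h => hmin ⟨h1, h2⟩ h

/-! ### The labeling is an EL-labeling -/

theorem atomIndex_lt {a b : AdmPart r n j} (hb : IsMin b) (h : word a.1 < word b.1) :
    atomIndex a < atomIndex b := by
  refine Set.ncard_lt_ncard ?_ (Set.toFinite _)
  refine ⟨fun c hc => ⟨hc.1, hc.2.trans h.le⟩, fun hcon => ?_⟩
  have hmem : b ∈ {c : AdmPart r n j | IsAtom (c : Lat r n j) ∧ word c.1 ≤ word b.1} :=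
    ⟨bot_covBy_iff.1 (WithBot.bot_covBy_coe.2 hb), le_rfl⟩
  exact ((hcon hmem).2.trans_lt h).false

theorem isELLabeling_pairLabel (hr : 0 < r) (hj : 0 < j) :
    IsELLabeling (pairLabel : Lat r n j → Lat r n j → _) := by
  apply isELLabeling_of_exists_first
  intro x y hxy
  induction y using WithBot.recBotCoe with
  | bot => exact absurd hxy not_lt_bot
  | coe y =>
  have hup : ∀ (a : AdmPart r n j) (a' : Lat r n j), (a : Lat r n j) ⋖ a' → a' ≤ y →
      ∃ (b : AdmPart r n j) (B C : Finset ℕ), a' = (b : Lat r n j) ∧ Merges a.1 b.1 B C ∧ b ≤ y := by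
    intro a a' haa' hay
    induction a' using WithBot.recBotCoe with
    | bot => exact absurd haa'.lt not_lt_bot
    | coe b =>
      obtain ⟨B, C, h⟩ := covBy_iff.1 (WithBot.coe_covBy_coe.1 haa')
      exact ⟨b, B, C, rfl, h, WithBot.coe_le_coe.1 hay⟩
  have hlam : ∀ k l : ℤ, k ≤ l → (toLex (k, 0) : Label) ≤ toLex (l, 0) := fun k l h =>
    Prod.Lex.toLex_le_toLex.2 <| h.lt_or_eq.imp id fun h => ⟨h, le_rfl⟩
  have hlam' : ∀ k l : ℤ, ∀ p q : ℕ, k < l → (toLex (k, p) : Label) < toLex (l, q) :=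
    fun k l p q h => Prod.Lex.toLex_lt_toLex.2 (Or.inl h)
  induction x using WithBot.recBotCoe with
  | bot =>
    -- The separated atom comes first: merges above it have positive labels, whereas every other
    -- atom has an overlapping pair, with a negative label.
    obtain ⟨a, ha, hay, hsep, hmin⟩ := exists_isMin_separated hr hj y
    refine ⟨a, WithBot.bot_covBy_coe.2 ha, WithBot.coe_le_coe.2 hay, ?_, ?_, ?_⟩
    · intro b hb hby hne
      induction b using WithBot.recBotCoe with
      | bot => exact absurd hb.lt (lt_irrefl _)
      | coe b =>
        have hb' := WithBot.bot_covBy_coe.1 hb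
        have := atomIndex_lt hb' (hmin b hb' (WithBot.coe_le_coe.1 hby)
          fun h => hne (by rw [h])).1
        exact pairLabel_lt_of_lam_lt (Prod.Lex.toLex_lt_toLex.2 (Or.inr ⟨rfl, this⟩))
    · intro a' haa' ha'y
      obtain ⟨b, B, C, rfl, h, hby⟩ := hup a a' haa' ha'y
      refine pairLabel_lt_of_lam_lt ?_
      rw [lam_eq h]
      refine hlam' _ _ _ _ ?_
      have hs := hsep B h.1 C h.2.1 h.2.2.1 ((h.le_iff hay).1 hby)
      rw [mergeLabel, if_neg hs.not_gt]
      have := block_facts h.2.1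
      dsimp only
      omega
    · intro b hb hby hne
      induction b using WithBot.recBotCoe with
      | bot => exact absurd hb.lt (lt_irrefl _)
      | coe b =>
        have hby' := WithBot.coe_le_coe.1 hby
        have hs := (hmin b (WithBot.bot_covBy_coe.1 hb) hby' fun h => hne (by rw [h])).2
        unfold IsSeparated at hs
        push Not at hs
        obtain ⟨B, hB, C, hC, hlt, hy, hov⟩ := hs
        obtain ⟨z, hz⟩ := exists_merges hB hC hlt
        refine ⟨z, WithBot.coe_covBy_coe.2 (covBy_iff.2 ⟨B, C, hz⟩),
          WithBot.coe_le_coe.2 ((hz.le_iff hby').2 hy), pairLabel_le_of_lam_le hr hj hb ?_⟩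
        rw [lam_eq hz]
        refine (hlam' _ _ _ _ ?_).le
        rw [mergeLabel, if_pos hov]
        have := block_facts hB
        dsimp only
        omega
  | coe x =>
    obtain ⟨a, B, C, h⟩ := exists_isFirstMerge (WithBot.coe_lt_coe.1 hxy)
    refine ⟨a, WithBot.coe_covBy_coe.2 (covBy_iff.2 ⟨B, C, h.merges⟩), WithBot.coe_le_coe.2 h.le,
      ?_, ?_, ?_⟩
    · intro b hb hby hne
      obtain ⟨b, D, E, rfl, hb', hby'⟩ := hup x b hb hby
      refine pairLabel_lt_of_lam_lt ?_
      rw [lam_eq h.merges, lam_eq hb', ← h.merges.symmLabel, ← hb'.symmLabel]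
      refine hlam' _ _ _ _ (h.lt_of_ne hb' hby' fun he => hne ?_)
      simp only [Prod.mk.injEq] at he
      obtain ⟨rfl, rfl⟩ := he
      rw [WithBot.coe_inj]
      exact Subtype.ext (Finpartition.ext (hb'.2.2.2.trans h.merges.2.2.2.symm))
    · intro a' haa' ha'y
      obtain ⟨b, D, E, rfl, hb, hby⟩ := hup a a' haa' ha'y
      refine pairLabel_lt_of_lam_lt ?_
      rw [lam_eq h.merges, lam_eq hb, ← h.merges.symmLabel, ← hb.symmLabel]
      exact hlam' _ _ _ _ (h.lt_of_merges hb hby)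
    · intro b hb hby hne
      obtain ⟨b, D, E, rfl, hb', hby'⟩ := hup x b hb hby
      obtain ⟨F, G, c, h1, h2, h3⟩ := h.exists_le_of_ne hb' hby' fun he => hne (by
        simp only [Prod.mk.injEq] at he
        obtain ⟨rfl, rfl⟩ := he
        rw [WithBot.coe_inj]
        exact Subtype.ext (Finpartition.ext (hb'.2.2.2.trans h.merges.2.2.2.symm)))
      refine ⟨c, WithBot.coe_covBy_coe.2 (covBy_iff.2 ⟨F, G, h1⟩), WithBot.coe_le_coe.2 h2,
        pairLabel_le_of_lam_le hr hj hb ?_⟩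
      rw [lam_eq h1, lam_eq hb', ← hb'.symmLabel]
      exact hlam _ _ h3

variable {σ : Equiv.Perm ℕ}

/-! ### Splitting a permutation -/

/-- The cuts before the earlier position also precede the later one, so equal counts mean equal
sets. The inequality is needed for the induction. -/
theorem cutIndex_eq_iff_of_le {S : List ℕ} {a b : ℕ} (hab : σ.symm a ≤ σ.symm b) :
    cutIndex σ S a ≤ cutIndex σ S b ∧
      (cutIndex σ S a = cutIndex σ S b ↔ ∀ s ∈ S, s < σ.symm a ↔ s < σ.symm b) := by
  unfold cutIndex
  induction S with
  | nil => simp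
  | cons s S ih =>
    obtain ⟨h1, h2⟩ := ih
    simp only [List.filter_cons, List.forall_mem_cons, decide_eq_true_eq]
    rw [← h2]
    split_ifs with h3 h4 h4
    · simp [h3, h4, h1]
    · omega
    · simp only [List.length_cons, h3, h4, iff_true, false_and, iff_false]
      omega
    · simp [h3, h4, h1]

theorem cutIndex_eq_iff (S : List ℕ) (a b : ℕ) :
    cutIndex σ S a = cutIndex σ S b ↔ ∀ s ∈ S, s < σ.symm a ↔ s < σ.symm b := by
  rcases le_total (σ.symm a) (σ.symm b) with h | h
  · exact (cutIndex_eq_iff_of_le h).2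
  · rw [eq_comm, (cutIndex_eq_iff_of_le h).2]
    simp only [iff_comm]

theorem part_splitAt_eq_iff (S : List ℕ) {a b : ℕ} (ha : a ∈ Finset.Icc 1 (r * n + j))
    (hb : b ∈ Finset.Icc 1 (r * n + j)) :
    (splitAt r n j σ S).part a = (splitAt r n j σ S).part b ↔
      ∀ s ∈ S, s < σ.symm a ↔ s < σ.symm b := by
  rw [← cutIndex_eq_iff, ← Finpartition.mem_part_iff_part_eq_part _ ha hb, splitAt,
    Finpartition.mem_part_ofSetSetoid_iff_rel]
  simp only [ha, hb, true_and]
  exact eq_comm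

theorem descOrder_perm (r n : ℕ) (σ : Equiv.Perm ℕ) :
    (descOrder r n σ).Perm (List.range' 1 n) := List.mergeSort_perm _ _

theorem mem_descOrder {t : ℕ} : t ∈ descOrder r n σ ↔ 1 ≤ t ∧ t ≤ n := by
  rw [(descOrder_perm r n σ).mem_iff, List.mem_range'_1]
  omega

theorem length_descOrder : (descOrder r n σ).length = n := by
  rw [(descOrder_perm r n σ).length_eq, List.length_range']

theorem nodup_descOrder : (descOrder r n σ).Nodup :=
  (descOrder_perm r n σ).nodup_iff.2 List.nodup_range'

theorem pairwise_descOrder (hr : 0 < r) :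
    (descOrder r n σ).Pairwise fun s t => σ (r * t) < σ (r * s) := by
  have h1 : (descOrder r n σ).Pairwise fun s t => decide (σ (r * t) ≤ σ (r * s)) = true :=
    List.pairwise_mergeSort (fun a b c => by simp only [decide_eq_true_eq]; omega)
      (fun a b => by simp only [Bool.or_eq_true, decide_eq_true_eq]; omega) _
  refine (h1.and (nodup_descOrder (r := r) (n := n) (σ := σ))).imp fun {a b} h => ?_
  refine lt_of_le_of_ne (by simpa using h.1) fun he => h.2 ?_
  exact (Nat.eq_of_mul_eq_mul_left hr (σ.injective he)).symm

/-- The `k` splitting positions `r t₁, …, r tₖ`. -/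
def topCuts (r n : ℕ) (σ : Equiv.Perm ℕ) (k : ℕ) : List ℕ :=
  ((descOrder r n σ).take k).map (r * ·)

theorem mem_topCuts_iff (hr : 0 < r) {t k : ℕ} :
    r * t ∈ topCuts r n σ k ↔ t ∈ (descOrder r n σ).take k := by
  simp only [topCuts, List.mem_map]
  exact ⟨fun ⟨u, hu, he⟩ => Nat.eq_of_mul_eq_mul_left hr he ▸ hu, fun h => ⟨t, h, rfl⟩⟩

theorem exists_of_mem_topCuts {s k : ℕ} (h : s ∈ topCuts r n σ k) :
    ∃ t, 1 ≤ t ∧ t ≤ n ∧ s = r * t := by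
  obtain ⟨t, ht, rfl⟩ := List.mem_map.1 h
  have := mem_descOrder.1 (List.mem_of_mem_take ht)
  exact ⟨t, this.1, this.2, rfl⟩

theorem lt_of_mem_take (hr : 0 < r) {t u k : ℕ} (ht : t ∈ (descOrder r n σ).take k)
    (hu : 1 ≤ u ∧ u ≤ n) (hu' : u ∉ (descOrder r n σ).take k) : σ (r * u) < σ (r * t) := by
  have h := pairwise_descOrder (n := n) (σ := σ) hr
  have hu2 := mem_descOrder (r := r) (σ := σ) |>.2 hu
  rw [← List.take_append_drop k (descOrder r n σ)] at h hu2
  exact (List.pairwise_append.1 h).2.2 t ht u ((List.mem_append.1 hu2).resolve_left hu')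

theorem symm_mem_Icc (hσ : σ ∈ descPerms r n j) {a : ℕ} :
    σ.symm a ∈ Finset.Icc 1 (r * n + j) ↔ a ∈ Finset.Icc 1 (r * n + j) := by
  constructor
  · intro h
    by_contra hn
    rw [σ.symm_apply_eq.2 (hσ.1 a hn).symm] at h
    exact hn h
  · intro h
    by_contra hn
    have := hσ.1 _ hn
    rw [σ.apply_symm_apply] at this
    rw [← this] at hn
    exact hn h

theorem apply_mem_Icc (hσ : σ ∈ descPerms r n j) {i : ℕ} :
    σ i ∈ Finset.Icc 1 (r * n + j) ↔ i ∈ Finset.Icc 1 (r * n + j) := by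
  rw [← symm_mem_Icc hσ, σ.symm_apply_apply]

theorem card_eq_of_mem_iff {m p q : ℕ} {B : Finset ℕ} (hB : B ⊆ Finset.Icc 1 m)
    (hσ : ∀ i, σ i ∈ Finset.Icc 1 m ↔ i ∈ Finset.Icc 1 m) (hq : q ≤ m)
    (h : ∀ a ∈ Finset.Icc 1 m, a ∈ B ↔ p < σ.symm a ∧ σ.symm a ≤ q) : B.card = q - p := by
  have : B = (Finset.Ioc p q).image σ := by
    ext a
    simp only [Finset.mem_image, Finset.mem_Ioc]
    constructor
    · intro ha
      exact ⟨σ.symm a, (h a (hB ha)).1 ha, σ.apply_symm_apply a⟩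
    · rintro ⟨i, hi, rfl⟩
      rw [h, σ.symm_apply_apply]
      · exact hi
      · rw [hσ, Finset.mem_Icc]; omega
  rw [this, Finset.card_image_of_injective _ σ.injective, Nat.card_Ioc]

theorem mem_topCuts_self (hr : 0 < r) {t : ℕ} (ht : 1 ≤ t) (htn : t ≤ n) :
    r * t ∈ topCuts r n σ n := by
  rw [mem_topCuts_iff hr, List.take_of_length_le length_descOrder.le]
  exact mem_descOrder.2 ⟨ht, htn⟩

/-- All cuts together leave `n` segments of length `r` and a last one of length `j`, which ends in
`m`. -/
theorem hasMinimalBlocks_splitAt (hr : 0 < r) (hj : 0 < j) (hσ : σ ∈ descPerms r n j) :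
    HasMinimalBlocks (splitAt r n j σ (topCuts r n σ n)) := by
  set x := splitAt r n j σ (topCuts r n σ n) with hx
  intro B hB
  obtain ⟨e, he⟩ := x.nonempty_of_mem_parts hB
  have heI := x.subset hB he
  have hp := Finset.mem_Icc.1 ((symm_mem_Icc hσ).2 heI)
  have hmem : ∀ a ∈ Finset.Icc 1 (r * n + j), a ∈ B ↔
      ∀ t, 1 ≤ t → t ≤ n → (r * t < σ.symm a ↔ r * t < σ.symm e) := by
    intro a ha
    rw [← x.part_eq_of_mem hB he, x.mem_part_iff_part_eq_part ha heI,
      part_splitAt_eq_iff _ ha heI]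
    constructor
    · exact fun h t h1 h2 => h _ (mem_topCuts_self hr h1 h2)
    · intro h s hs
      obtain ⟨t, h1, h2, rfl⟩ := exists_of_mem_topCuts hs
      exact h t h1 h2
  have hmI := max_mem_Icc (r := r) (n := n) hj
  have hm : σ.symm (r * n + j) = r * n + j := σ.symm_apply_eq.2 hσ.2.2.symm
  by_cases hc : r * n < σ.symm e
  · have hiff : ∀ a ∈ Finset.Icc 1 (r * n + j), a ∈ B ↔
        r * n < σ.symm a ∧ σ.symm a ≤ r * n + j := by
      intro a ha
      have h1 := Finset.mem_Icc.1 ((symm_mem_Icc hσ).2 ha)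
      have hle : ∀ t ≤ n, r * t ≤ r * n := fun t ht => Nat.mul_le_mul_left r ht
      rw [hmem a ha]
      constructor
      · intro h
        refine ⟨?_, h1.2⟩
        rcases Nat.eq_zero_or_pos n with rfl | hn
        · omega
        · exact (h n hn le_rfl).2 hc
      · intro h t _ htn
        have := hle t htn
        omega
    refine ⟨fun _ => ?_, fun h => absurd ((hiff _ hmI).2 ⟨by omega, hm.le⟩) h⟩
    rw [card_eq_of_mem_iff (x.subset hB) (fun i => apply_mem_Icc hσ) le_rfl hiff]
    omega
  · obtain ⟨q, hq1, hq2, hqn⟩ : ∃ q, r * q < σ.symm e ∧ σ.symm e ≤ r * (q + 1) ∧ q + 1 ≤ n := by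
      -- The segments are `(r q, r (q + 1)]`; subtracting one keeps the right endpoint in its
      -- segment.
      refine ⟨(σ.symm e - 1) / r, ?_, ?_, ?_⟩
      · have := Nat.mul_div_le (σ.symm e - 1) r
        omega
      · have := Nat.lt_mul_div_succ (σ.symm e - 1) hr
        omega
      · have : (σ.symm e - 1) / r < n := by
          rw [Nat.div_lt_iff_lt_mul hr, mul_comm]
          omega
        omega
    have hiff : ∀ a ∈ Finset.Icc 1 (r * n + j), a ∈ B ↔
        r * q < σ.symm a ∧ σ.symm a ≤ r * (q + 1) := by
      intro a ha
      have h1 := Finset.mem_Icc.1 ((symm_mem_Icc hσ).2 ha)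
      rw [hmem a ha]
      constructor
      · intro h
        constructor
        · rcases Nat.eq_zero_or_pos q with rfl | hn
          · omega
          · exact (h q hn (by omega)).2 hq1
        · have := h (q + 1) (by omega) hqn
          omega
      · intro h t _ htn
        rcases le_or_gt t q with htq | htq
        · have := Nat.mul_le_mul_left r htq
          omega
        · have := Nat.mul_le_mul_left r (Nat.succ_le_of_lt htq)
          rw [Nat.succ_eq_add_one] at this
          omega
    have hle := Nat.mul_le_mul_left r hqn
    refine ⟨fun h => ?_, fun _ => ?_⟩
    · have := ((hiff _ hmI).1 h).2
      omega
    · rw [card_eq_of_mem_iff (x.subset hB) (fun i => apply_mem_Icc hσ) (by omega) hiff, mul_add]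
      omega

/-- A block of `y` is a union of blocks of `x`, so its size is a sum of theirs. -/
theorem Admissible.of_le (hj : 0 < j) {x y : Part r n j} (hx : Admissible r n j x) (h : x ≤ y) :
    Admissible r n j y := by
  intro Y hY
  have hsub : ∀ e ∈ Y, x.part e ⊆ Y := fun e he =>
    (Finpartition.part_subset_part h e).trans (y.part_eq_of_mem hY he).subset
  constructor
  · intro hm
    have hmI := max_mem_Icc (r := r) (n := n) hj
    exact ((hx _ (x.part_mem.2 hmI)).1 (x.mem_part_self.2 hmI)).trans
      (Finset.card_le_card (hsub _ hm))
  · intro hm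
    rw [Finset.card_eq_sum_card_fiberwise (f := x.part) (t := x.parts)
      fun e he => x.part_mem.2 (y.subset hY he)]
    refine Finset.dvd_sum fun D hD => ?_
    by_cases hDY : D ⊆ Y
    · have : Y.filter (fun e => x.part e = D) = D := by
        ext e
        rw [Finset.mem_filter, x.part_eq_iff_mem hD]
        exact ⟨fun h => h.2, fun h => ⟨hDY h, h⟩⟩
      rw [this]
      exact (hx D hD).2 fun h => hm (hDY h)
    · have : Y.filter (fun e => x.part e = D) = ∅ := by
        rw [Finset.filter_eq_empty_iff]
        rintro e he rfl
        exact hDY (hsub e he)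
      simp [this]

theorem splitAt_mono {S S' : List ℕ} (h : ∀ s ∈ S, s ∈ S') :
    splitAt r n j σ S' ≤ splitAt r n j σ S :=
  Finpartition.le_of_part fun a ha b hb hab => by
    rw [part_splitAt_eq_iff _ ha hb] at hab ⊢
    exact fun s hs => hab s (h s hs)

theorem topCuts_subset {k k' : ℕ} (h : k ≤ k') : ∀ s ∈ topCuts r n σ k, s ∈ topCuts r n σ k' :=
  List.map_subset _ (List.take_subset_take_left _ h)

theorem admissible_splitAt (hr : 0 < r) (hj : 0 < j) (hσ : σ ∈ descPerms r n j) (k : ℕ) :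
    Admissible r n j (splitAt r n j σ (topCuts r n σ k)) := by
  have hmin := hasMinimalBlocks_splitAt hr hj hσ
  have h1 : Admissible r n j (splitAt r n j σ (topCuts r n σ n)) := fun D hD =>
    ⟨fun h => ((hmin D hD).1 h).ge, fun h => ((hmin D hD).2 h).symm.dvd⟩
  refine h1.of_le hj (splitAt_mono ?_)
  rcases le_total k n with h | h
  · exact topCuts_subset h
  · intro s hs
    obtain ⟨t, h1, h2, rfl⟩ := exists_of_mem_topCuts hs
    exact mem_topCuts_self hr h1 h2


/-- The last letter of a segment is its maximum. -/
theorem apply_le_of_segment (hr : 0 < r) (hσ : σ ∈ descPerms r n j) {k p q : ℕ} (hp : 1 ≤ p)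
    (hpq : p ≤ q) (hqm : q ≤ r * n + j) (hq : q ∈ topCuts r n σ k ∨ q = r * n + j)
    (hcut : ∀ s ∈ topCuts r n σ k, p ≤ s → q ≤ s) : σ p ≤ σ q := by
  obtain ⟨d, rfl⟩ := Nat.exists_eq_add_of_le hpq
  induction d generalizing p with
  | zero => exact le_rfl
  | succ d ih =>
    by_cases hdes : σ (p + 1) < σ p
    -- A descent inside the segment is at an uncut position `r t`. Cuts are made at the largest
    -- values first, so its value is below that at any cut; and `m` bounds everything.
    · obtain ⟨t, ht1, ht2, rfl⟩ := (hσ.2.1 p).1 ⟨hp, by omega, hdes⟩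
      have hnot : r * t ∉ topCuts r n σ k := fun h => by
        have := hcut _ h le_rfl
        omega
      rcases hq with hq | hq
      · obtain ⟨u, -, -, hu⟩ := exists_of_mem_topCuts hq
        rw [hu, mem_topCuts_iff hr] at hq
        rw [hu]
        rw [mem_topCuts_iff hr] at hnot
        exact (lt_of_mem_take hr hq ⟨ht1, ht2⟩ hnot).le
      · rw [hq, hσ.2.2]
        exact (Finset.mem_Icc.1 ((apply_mem_Icc hσ).2 (Finset.mem_Icc.2 ⟨hp, by omega⟩))).2
    · have he : p + (d + 1) = p + 1 + d := by omega
      rw [he] at hqm hq hcut ⊢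
      exact (not_lt.1 hdes).trans (ih (by omega) (by omega) hqm hq
        fun s hs hps => hcut s hs (by omega))

theorem topCuts_succ {k : ℕ} (hk : k < n) : ∃ t, 1 ≤ t ∧ t ≤ n ∧
    topCuts r n σ (k + 1) = topCuts r n σ k ++ [r * t] ∧ t ∉ (descOrder r n σ).take k := by
  have hk' : k < (descOrder r n σ).length := by rwa [length_descOrder]
  have hmem := mem_descOrder.1 (List.getElem_mem hk')
  refine ⟨(descOrder r n σ)[k], hmem.1, hmem.2, ?_, fun h => ?_⟩
  · rw [topCuts, List.take_succ_eq_append_getElem hk', List.map_append]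
    rfl
  · have hnd : ((descOrder r n σ).take (k + 1)).Nodup := nodup_descOrder.sublist
      (List.take_sublist _ _)
    rw [List.take_succ_eq_append_getElem hk', List.nodup_append] at hnd
    exact hnd.2.2 _ h _ (List.mem_singleton_self _) rfl

theorem part_splitAt_succ (hr : 0 < r) (hj : 0 < j) (hσ : σ ∈ descPerms r n j) {k t : ℕ}
    (ht1 : 1 ≤ t) (htn : t ≤ n) (hcuts : topCuts r n σ (k + 1) = topCuts r n σ k ++ [r * t])
    (ht : t ∉ (descOrder r n σ).take k) :
    σ (r * t) ∈ Finset.Icc 1 (r * n + j) ∧ σ (r * t + 1) ∈ Finset.Icc 1 (r * n + j) ∧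
    (splitAt r n j σ (topCuts r n σ (k + 1))).part (σ (r * t)) ≠
      (splitAt r n j σ (topCuts r n σ (k + 1))).part (σ (r * t + 1)) ∧
    (splitAt r n j σ (topCuts r n σ k)).part (σ (r * t)) =
      (splitAt r n j σ (topCuts r n σ k)).part (σ (r * t + 1)) := by
  have hpos : 0 < r * t := Nat.mul_pos hr ht1
  have hle := Nat.mul_le_mul_left r htn
  have h1 : σ (r * t) ∈ Finset.Icc 1 (r * n + j) :=
    (apply_mem_Icc hσ).2 (Finset.mem_Icc.2 ⟨hpos, by omega⟩)
  have h2 : σ (r * t + 1) ∈ Finset.Icc 1 (r * n + j) :=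
    (apply_mem_Icc hσ).2 (Finset.mem_Icc.2 ⟨by omega, by omega⟩)
  refine ⟨h1, h2, fun h => ?_, ?_⟩
  · rw [part_splitAt_eq_iff _ h1 h2] at h
    have := h (r * t) (by simp [hcuts])
    simp at this
  · rw [part_splitAt_eq_iff _ h1 h2]
    intro s hs
    rw [σ.symm_apply_apply, σ.symm_apply_apply]
    have : s ≠ r * t := by
      rintro rfl
      exact ht ((mem_topCuts_iff hr).1 hs)
    omega

/-- The partition `f_σ` with `k + 1` blocks. -/
def splitPart (hr : 0 < r) (hj : 0 < j) (hσ : σ ∈ descPerms r n j) (k : ℕ) : AdmPart r n j :=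
  ⟨splitAt r n j σ (topCuts r n σ k), admissible_splitAt hr hj hσ k⟩

theorem splitPart_lt (hr : 0 < r) (hj : 0 < j) (hσ : σ ∈ descPerms r n j) {k : ℕ} (hk : k < n) :
    splitPart hr hj hσ (k + 1) < splitPart hr hj hσ k := by
  obtain ⟨t, ht1, htn, hcuts, ht⟩ := topCuts_succ (r := r) (σ := σ) hk
  obtain ⟨h1, h2, h3, h4⟩ := part_splitAt_succ hr hj hσ ht1 htn hcuts ht
  refine lt_of_le_of_ne (splitAt_mono (topCuts_subset (Nat.le_succ k))) fun he => h3 ?_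
  have he' : splitAt r n j σ (topCuts r n σ (k + 1)) = splitAt r n j σ (topCuts r n σ k) :=
    congrArg Subtype.val he
  rw [he', h4]

/-- Each of the `n` cuts adds at least one block, starting from at least one block and ending with
at most `n + 1`; so each adds exactly one. -/
theorem card_splitPart (hr : 0 < r) (hj : 0 < j) (hσ : σ ∈ descPerms r n j) {k : ℕ} (hk : k ≤ n) :
    (splitPart hr hj hσ k).1.parts.card = k + 1 := by
  have hlt : ∀ k < n, (splitPart hr hj hσ k).1.parts.card <
      (splitPart hr hj hσ (k + 1)).1.parts.card := fun k hk =>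
    card_parts_strictAnti (splitPart_lt hr hj hσ hk)
  have hlow : ∀ k ≤ n, k + 1 ≤ (splitPart hr hj hσ k).1.parts.card := by
    intro k
    induction k with
    | zero =>
      exact fun _ => Nat.succ_le_of_lt (Finset.card_pos.2
        ⟨_, (Finpartition.part_mem _).2 (max_mem_Icc hj)⟩)
    | succ k ih => exact fun h => by have := hlt k h; have := ih (by omega); omega
  have hup : ∀ d ≤ n, (splitPart hr hj hσ (n - d)).1.parts.card ≤ n - d + 1 := by
    intro d
    induction d with
    | zero => exact fun _ => card_parts_le hr hj _
    | succ d ih =>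
      intro h
      have h1 := hlt (n - (d + 1)) (by omega)
      rw [show n - (d + 1) + 1 = n - d by omega] at h1
      have := ih (by omega)
      omega
  have h1 := hlow k hk
  have h2 := hup (n - k) (by omega)
  rw [show n - (n - k) = k by omega] at h2
  omega

theorem splitPart_zero (hr : 0 < r) (hj : 0 < j) (hσ : σ ∈ descPerms r n j) :
    splitPart hr hj hσ 0 = ⊤ := by
  by_contra hne
  have h1 := card_parts_strictAnti (lt_top_iff_ne_top.2 hne)
  have h2 := card_splitPart hr hj hσ (Nat.zero_le n)
  have h3 : 0 < (⊤ : AdmPart r n j).1.parts.card := Finset.card_pos.2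
    ⟨_, Finpartition.part_mem _ |>.2 (max_mem_Icc hj)⟩
  dsimp only at h1
  omega

theorem splitPart_covBy (hr : 0 < r) (hj : 0 < j) (hσ : σ ∈ descPerms r n j) {k : ℕ} (hk : k < n) :
    splitPart hr hj hσ (k + 1) ⋖ splitPart hr hj hσ k := by
  refine ⟨splitPart_lt hr hj hσ hk, fun z h1 h2 => ?_⟩
  have := card_parts_strictAnti h1
  have := card_parts_strictAnti h2
  have : (splitPart hr hj hσ (k + 1)).1.parts.card = k + 1 + 1 := card_splitPart hr hj hσ hk
  have := card_splitPart hr hj hσ hk.le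
  dsimp only at *
  omega

/-- The cut at `r t` separates a segment with maximum `σ(r t)`, its last letter, from one with a
larger maximum, which ends at a cut of larger value or at `m`. The descent at `r t` makes the two
overlap. -/
theorem lam_splitPart (hr : 0 < r) (hj : 0 < j) (hσ : σ ∈ descPerms r n j) {k : ℕ} (hk : k < n)
    {t : ℕ} (ht1 : 1 ≤ t) (htn : t ≤ n)
    (hcuts : topCuts r n σ (k + 1) = topCuts r n σ k ++ [r * t])
    (ht : t ∉ (descOrder r n σ).take k) :
    lam (splitPart hr hj hσ (k + 1) : Lat r n j) (splitPart hr hj hσ k) =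
      toLex (-(σ (r * t) : ℤ), 0) := by
  obtain ⟨h1, h2, h3, h4⟩ := part_splitAt_succ hr hj hσ ht1 htn hcuts ht
  obtain ⟨C, D, h⟩ := covBy_iff.1 (splitPart_covBy hr hj hσ hk)
  have hx : (splitPart hr hj hσ (k + 1)).1 = splitAt r n j σ (topCuts r n σ (k + 1)) := rfl
  have hy : (splitPart hr hj hσ k).1 = splitAt r n j σ (topCuts r n σ k) := rfl
  rw [lam_eq h]
  rw [hx, hy] at h
  set x := splitAt r n j σ (topCuts r n σ (k + 1))
  set y := splitAt r n j σ (topCuts r n σ k)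
  have hpos : 0 < r * t := Nat.mul_pos hr ht1
  have hle := Nat.mul_le_mul_left r htn
  have hsmem : r * t ∈ topCuts r n σ (k + 1) := by simp [hcuts]
  have hE := x.part_mem.2 h1
  have hF := x.part_mem.2 h2
  have hmaxE : blockMax (x.part (σ (r * t))) = σ (r * t) := by
    refine blockMax_eq (x.mem_part_self.2 h1) fun a ha => ?_
    have haI := x.subset hE ha
    rw [x.mem_part_iff_part_eq_part haI h1, part_splitAt_eq_iff _ haI h1] at ha
    simp only [σ.symm_apply_apply] at ha
    have h5 := ha _ hsmem
    have h6 := Finset.mem_Icc.1 ((symm_mem_Icc hσ).2 haI)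
    have := apply_le_of_segment hr hσ (k := k + 1) (p := σ.symm a) (q := r * t) h6.1 (by omega)
      (by omega) (Or.inl hsmem) fun s hs hps => by
        have := ha s hs
        omega
    rwa [σ.apply_symm_apply] at this
  have hmaxF : σ (r * t) < blockMax (x.part (σ (r * t + 1))) := by
    -- The least such `q` is the end of the segment that follows `r t`.
    have hex : ∃ q, r * t + 1 ≤ q ∧ q ≤ r * n + j ∧ (q ∈ topCuts r n σ k ∨ q = r * n + j) :=
      ⟨r * n + j, by omega, le_rfl, Or.inr rfl⟩
    classical
    obtain ⟨hq1, hqm, hq2⟩ := Nat.find_spec hex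
    have hmin : ∀ s ∈ topCuts r n σ k, r * t + 1 ≤ s → Nat.find hex ≤ s := by
      intro s hs hts
      refine Nat.find_min' hex ⟨hts, ?_, Or.inl hs⟩
      obtain ⟨u, -, hu, rfl⟩ := exists_of_mem_topCuts hs
      have := Nat.mul_le_mul_left r hu
      omega
    set q := Nat.find hex
    have hqI : σ q ∈ Finset.Icc 1 (r * n + j) :=
      (apply_mem_Icc hσ).2 (Finset.mem_Icc.2 ⟨by omega, hqm⟩)
    have hqF : σ q ∈ x.part (σ (r * t + 1)) := by
      rw [x.mem_part_iff_part_eq_part hqI h2, part_splitAt_eq_iff _ hqI h2]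
      intro s hs
      rw [σ.symm_apply_apply, σ.symm_apply_apply]
      rw [hcuts, List.mem_append, List.mem_singleton] at hs
      rcases hs with hs | rfl
      · have := hmin s hs
        omega
      · omega
    refine lt_of_lt_of_le ?_ (le_blockMax hqF)
    rcases hq2 with hq2 | hq2
    · obtain ⟨u, -, -, hu⟩ := exists_of_mem_topCuts hq2
      rw [hu, mem_topCuts_iff hr] at hq2
      rw [hu]
      exact lt_of_mem_take hr hq2 ⟨ht1, htn⟩ ht
    · refine lt_of_le_of_ne ?_ fun h => by
        have := σ.injective h
        omega
      rw [hq2, hσ.2.2]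
      exact (Finset.mem_Icc.1 h1).2
  -- The pair given by the cover relation consists of these two segments, and their maxima fix the
  -- order.
  have hCD : x.part (σ (r * t)) = C ∧ x.part (σ (r * t + 1)) = D := by
    have hU : ∀ a ∈ Finset.Icc 1 (r * n + j), a ∈ y.part (σ (r * t)) → a ∈ C ∨ a ∈ D := by
      intro a ha hay
      rcases h.mem_parts_iff.1 (y.part_mem.2 h1) with hU | hU
      · rw [hU] at hay
        exact Finset.mem_union.1 hay
      · refine absurd ?_ h3
        rw [x.part_eq_of_mem hU.1 (y.mem_part_self.2 h1), x.part_eq_of_mem hU.1]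
        rw [h4]
        exact y.mem_part_self.2 h2
    have hlt := h.2.2.1
    rcases hU _ h1 (y.mem_part_self.2 h1) with he | he <;>
    rcases hU _ h2 (h4 ▸ y.mem_part_self.2 h2) with hf | hf
    · exact absurd ((x.part_eq_of_mem h.1 he).trans (x.part_eq_of_mem h.1 hf).symm) h3
    · exact ⟨x.part_eq_of_mem h.1 he, x.part_eq_of_mem h.2.1 hf⟩
    · rw [x.part_eq_of_mem h.2.1 he] at hmaxE
      rw [x.part_eq_of_mem h.1 hf] at hmaxF
      omega
    · exact absurd ((x.part_eq_of_mem h.2.1 he).trans (x.part_eq_of_mem h.2.1 hf).symm) h3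
  obtain ⟨rfl, rfl⟩ := hCD
  have hdes := ((hσ.2.1 (r * t)).2 ⟨t, ht1, htn, rfl⟩).2.2
  have hmin := blockMin_le (x.mem_part_self.2 h2)
  rw [mergeLabel, if_pos (by dsimp only; omega), hmaxE]

theorem map_reverse_range_succ {α : Type*} (f : ℕ → α) (k : ℕ) :
    (List.range (k + 1)).reverse.map f = f k :: (List.range k).reverse.map f := by
  rw [List.range_succ, List.reverse_append]
  rfl

theorem isMaximalChain_splitPart (hr : 0 < r) (hj : 0 < j) (hσ : σ ∈ descPerms r n j) {k : ℕ}
    (hk : k ≤ n) : IsMaximalChain (splitPart hr hj hσ k : Lat r n j) ⊤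
      ((List.range (k + 1)).reverse.map fun i => (splitPart hr hj hσ i : Lat r n j)) := by
  induction k with
  | zero =>
    rw [splitPart_zero hr hj hσ]
    simp only [zero_add, List.range_one, List.reverse_singleton, List.map_singleton,
      splitPart_zero hr hj hσ]
    exact isMaximalChain_self _
  | succ k ih =>
    rw [map_reverse_range_succ]
    exact (ih (by omega)).cons (WithBot.coe_covBy_coe.2 (splitPart_covBy hr hj hσ hk))

/-- Going from `k + 1` cuts to `k` has label `-σ(r tₖ₊₁)`, and the cuts are removed in increasing
order of these values. -/
theorem isFalling_splitPart (hr : 0 < r) (hj : 0 < j) (hσ : σ ∈ descPerms r n j) {k : ℕ}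
    (hk : k ≤ n) : IsFalling pairLabel
      ((List.range (k + 1)).reverse.map fun i => (splitPart hr hj hσ i : Lat r n j)) := by
  induction k with
  | zero => exact List.isChain_nil
  | succ k ih =>
    have ih := ih (by omega)
    rcases k with _ | k
    · exact List.isChain_singleton _
    rw [map_reverse_range_succ, map_reverse_range_succ, map_reverse_range_succ]
    rw [map_reverse_range_succ, map_reverse_range_succ] at ih
    refine List.isChain_cons_cons.2 ⟨?_, ih⟩
    obtain ⟨t, ht1, htn, hcuts, ht⟩ := topCuts_succ (r := r) (σ := σ) (show k < n by omega)
    obtain ⟨u, hu1, hun, hcuts', hu⟩ := topCuts_succ (r := r) (σ := σ) (show k + 1 < n by omega)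
    refine pairLabel_le_of_lam_le hr hj
      (WithBot.coe_covBy_coe.2 (splitPart_covBy hr hj hσ (by omega))) ?_
    rw [lam_splitPart hr hj hσ (by omega) ht1 htn hcuts ht,
      lam_splitPart hr hj hσ (by omega) hu1 hun hcuts' hu]
    refine (Prod.Lex.toLex_lt_toLex.2 (Or.inl ?_)).le
    have hmem : t ∈ (descOrder r n σ).take (k + 1) := by
      rw [← mem_topCuts_iff hr, hcuts]
      simp
    have := lt_of_mem_take hr hmem ⟨hu1, hun⟩ hu
    dsimp only
    omega

theorem exists_chain_of_mem_descPerms (hr : 0 < r) (hj : 0 < j) (hσ : σ ∈ descPerms r n j) :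
    ∃ d : List (Lat r n j), IsMaximalChain ⊥ ⊤ d ∧ IsFalling pairLabel d ∧
      d.map Lat.val = fChain r n j σ := by
  refine ⟨⊥ :: (List.range (n + 1)).reverse.map fun i => (splitPart hr hj hσ i : Lat r n j),
    ?_, ?_, ?_⟩
  · refine (isMaximalChain_splitPart hr hj hσ le_rfl).cons ?_
    rw [WithBot.bot_covBy_coe, isMin_iff hr hj, ← card_parts_eq_iff hr hj]
    exact card_splitPart hr hj hσ le_rfl
  · have h := isFalling_splitPart hr hj hσ (le_refl n)
    rcases n with _ | n
    · exact List.isChain_singleton _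
    rw [map_reverse_range_succ, map_reverse_range_succ] at h ⊢
    refine List.isChain_cons_cons.2 ⟨?_, h⟩
    obtain ⟨t, ht1, htn, hcuts, ht⟩ := topCuts_succ (r := r) (σ := σ) (Nat.lt_succ_self n)
    -- The first edge has a label `0_i`, above every negative one.
    refine (pairLabel_lt_of_lam_lt ?_).le
    rw [lam_splitPart hr hj hσ (by omega) ht1 htn hcuts ht]
    refine Prod.Lex.toLex_lt_toLex.2 (Or.inl ?_)
    have := (part_splitAt_succ hr hj hσ ht1 htn hcuts ht).1
    rw [Finset.mem_Icc] at this
    dsimp only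
    omega
  · rw [List.map_cons, List.map_map]
    rfl

/-! ### Falling chains -/

/-- `x :: l` is a saturated chain to `⊤` in which each step merges overlapping blocks, and the
smaller maxima of the merged blocks form an increasing sequence that starts at `v` or above. -/
inductive IsFallingFrom : ℕ → AdmPart r n j → List (AdmPart r n j) → Prop
  | top (v : ℕ) : v ≤ r * n + j → IsFallingFrom v ⊤ []
  | cons {v : ℕ} {x y : AdmPart r n j} {l : List (AdmPart r n j)} {B C : Finset ℕ} :
      Merges x.1 y.1 B C → blockMin C < blockMax B → v ≤ blockMax B →
      IsFallingFrom (blockMax B) y l → IsFallingFrom v x (y :: l)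

/-- The label of the preceding edge is carried along as `-v`, where `v = 0` accounts for `0_i`; its
other components do not matter. A label bounded by it is not positive, so the merged blocks overlap.
-/
theorem isFallingFrom_of_isFalling {x : AdmPart r n j} {l : List (AdmPart r n j)} {v q : ℕ}
    {p : ℤ} (hv : v ≤ r * n + j)
    (hc : IsMaximalChain (x : Lat r n j) ⊤ ((x :: l).map WithBot.some))
    (hf : ((toLex (toLex (-(v : ℤ), q), p) : Label ×ₗ ℤ) ::
      labels pairLabel ((x :: l).map (WithBot.some : AdmPart r n j → Lat r n j))).IsChain (· ≥ ·)) :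
    IsFallingFrom v x l := by
  induction l generalizing x v p q with
  | nil =>
    have : x = ⊤ := by
      have := hc.2.1
      simpa using this
    subst this
    exact .top v hv
  | cons y l ih =>
    obtain ⟨h1, h2, h3⟩ := hc
    rw [List.map_cons, List.map_cons, List.isChain_cons_cons] at h3
    obtain ⟨B, C, h⟩ := covBy_iff.1 (WithBot.coe_covBy_coe.1 h3.1)
    rw [List.map_cons, List.map_cons, labels_cons_cons, List.isChain_cons_cons] at hf
    have hp : pairLabel (x : Lat r n j) (y : Lat r n j) =
        toLex (toLex (mergeLabel (B, C), 0), -(rank (x : Lat r n j) : ℤ)) := by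
      rw [pairLabel, lam_eq h]
    have hle : mergeLabel (B, C) ≤ -(v : ℤ) := by
      have h4 := hf.1
      rw [hp, ge_iff_le, Prod.Lex.toLex_le_toLex] at h4
      rcases h4 with h4 | h4
      · rcases Prod.Lex.toLex_lt_toLex.1 h4 with h5 | h5
        · exact h5.le
        · exact h5.1.le
      · exact (congrArg Prod.fst (toLex.injective h4.1)).le
    have hBf := block_facts h.1
    have hCf := block_facts h.2.1
    have hov : blockMin C < blockMax B := by
      by_contra hov
      rw [mergeLabel, if_neg hov] at hle
      dsimp only at hle
      omega
    rw [mergeLabel, if_pos hov] at hle hp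
    refine .cons h hov (by dsimp only at hle; omega) (ih (v := blockMax B) ?_ ?_ (hp ▸ hf.2))
    · exact (Finset.mem_Icc.1 (x.1.subset h.1 (blockMax_mem (x.1.nonempty_of_mem_parts h.1)))).2
    · exact ⟨rfl, by simpa using h2, h3.2⟩

/-- Each block maximum either is `m` or vanishes at some step as the smaller of two, and those are
at least `v`. -/
theorem IsFallingFrom.le_blockMax {v : ℕ} {x : AdmPart r n j} {l : List (AdmPart r n j)} (hj : 0 < j)
    (h : IsFallingFrom v x l) {D : Finset ℕ} (hD : D ∈ x.1.parts) : v ≤ blockMax D := by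
  induction h generalizing D with
  | top v hv =>
    have hD' := Finset.mem_singleton.1 (Finpartition.parts_top_subset _ hD)
    subst hD'
    exact hv.trans (ExtendedPartition.le_blockMax (max_mem_Icc hj))
  | @cons v x y l B C h hov hv _ ih =>
    by_cases hDB : D = B
    · rwa [hDB]
    by_cases hDC : D = C
    · rw [hDC]
      exact hv.trans h.2.2.1.le
    · exact hv.trans (ih (h.mem_parts_iff.2 (Or.inr ⟨hD, hDB, hDC⟩)))

theorem card_parts_top (hj : 0 < j) : (⊤ : AdmPart r n j).1.parts.card = 1 := by
  refine le_antisymm (Finset.card_le_one.2 (Finpartition.parts_top_subsingleton _)) ?_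
  exact Finset.card_pos.2 ⟨_, (Finpartition.part_mem _).2 (max_mem_Icc hj)⟩

/-- Numbers the chain by cuts, one fewer than blocks, as in `fChain`. -/
theorem IsFallingFrom.map_card {v : ℕ} {x : AdmPart r n j} {l : List (AdmPart r n j)} (hj : 0 < j)
    (h : IsFallingFrom v x l) : (x :: l).map (fun z => z.1.parts.card - 1) =
      (List.range x.1.parts.card).reverse := by
  induction h with
  | top v hv => simp [card_parts_top hj]
  | @cons v x y l B C h hov hv _ ih =>
    rw [List.map_cons, ih, h.card, List.range_succ, List.reverse_append]
    rfl

theorem IsFallingFrom.le {v : ℕ} {x : AdmPart r n j} {l : List (AdmPart r n j)}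
    (h : IsFallingFrom v x l) : ∀ z ∈ x :: l, x ≤ z := by
  induction h with
  | top v hv => simp
  | @cons v x y l B C h hov hv _ ih =>
    intro z hz
    rcases List.mem_cons.1 hz with rfl | hz
    · exact le_rfl
    · exact (show x ≤ y from h.le).trans (ih z hz)

/-- `idx` numbers the blocks of `x` in such a way that every block of a partition of the chain
`x :: l` consists of consecutive blocks of `x`, the last one of which contains its maximum,
consecutive blocks of `x` overlap, and the block maxima that disappear along the chain are smaller
than those that remain. -/
structure IsBlockOrder (x : AdmPart r n j) (l : List (AdmPart r n j)) (idx : ℕ → ℕ) : Prop where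
  eq_iff : ∀ a ∈ Finset.Icc 1 (r * n + j), ∀ b ∈ Finset.Icc 1 (r * n + j),
    idx a = idx b ↔ x.1.part a = x.1.part b
  le_max : ∀ z ∈ x :: l, ∀ a ∈ Finset.Icc 1 (r * n + j), idx a ≤ idx (blockMax (z.1.part a))
  convex : ∀ z ∈ x :: l, ∀ a ∈ Finset.Icc 1 (r * n + j), ∀ c ∈ Finset.Icc 1 (r * n + j),
    idx a ≤ idx c → idx c ≤ idx (blockMax (z.1.part a)) → z.1.part c = z.1.part a
  overlap : ∀ a ∈ Finset.Icc 1 (r * n + j), ∀ b ∈ Finset.Icc 1 (r * n + j), idx a < idx b →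
    (∀ c ∈ Finset.Icc 1 (r * n + j), idx a < idx c → idx b ≤ idx c) →
    blockMin (x.1.part b) < blockMax (x.1.part a)
  lt_max : ∀ z ∈ x :: l, ∀ a ∈ Finset.Icc 1 (r * n + j), ∀ b ∈ Finset.Icc 1 (r * n + j),
    blockMax (x.1.part a) = a → blockMax (z.1.part a) ≠ a → blockMax (z.1.part b) = b → a < b

/-- When `B ∪ C` is split, `B` is placed directly before `C`; doubling the old indices makes room.
The block before `B` overlaps it automatically, since the block maxima of `y` are at least `max B`
by `le_blockMax`. -/
theorem IsFallingFrom.exists_isBlockOrder {v : ℕ} {x : AdmPart r n j} {l : List (AdmPart r n j)}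
    (hj : 0 < j) (h : IsFallingFrom v x l) : ∃ idx, IsBlockOrder x l idx := by
  induction h with
  | top v hv =>
    have hpart : ∀ a ∈ Finset.Icc 1 (r * n + j), ∀ b ∈ Finset.Icc 1 (r * n + j),
        (⊤ : AdmPart r n j).1.part a = (⊤ : AdmPart r n j).1.part b := fun a ha b hb =>
      Finpartition.parts_top_subsingleton _ ((Finpartition.part_mem _).2 ha)
        ((Finpartition.part_mem _).2 hb)
    refine ⟨fun _ => 0, fun a ha b hb => by simpa using hpart a ha b hb, fun _ _ _ _ => le_rfl, ?_,
      fun _ _ _ _ h => absurd h (lt_irrefl _), ?_⟩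
    · intro z hz a ha c hc _ _
      obtain rfl := List.mem_singleton.1 hz
      exact hpart c hc a ha
    · intro z hz a _ b _ h1 h2
      obtain rfl := List.mem_singleton.1 hz
      exact absurd h1 h2
  | @cons v x y l B C h hov hv hl ih =>
    obtain ⟨idx, hi⟩ := ih
    have hyz := hl.le
    have hB := h.1
    have hC := h.2.1
    have hlt := h.2.2.1
    have hU := h.union_mem
    have hBm := blockMax_mem (x.1.nonempty_of_mem_parts hB)
    have hCm := blockMax_mem (x.1.nonempty_of_mem_parts hC)
    have hBI := x.1.subset hB hBm
    have hCI := x.1.subset hC hCm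
    have hUmax := h.blockMax_union
    have hdis : ∀ e ∈ B, e ∉ C := fun e h1 h2 => h.ne (x.1.eq_of_mem_parts hB hC h1 h2)
    -- the blocks of `y` in terms of those of `x`
    have hyU : ∀ e, e ∈ B ∪ C → y.1.part e = B ∪ C := fun e he => y.1.part_eq_of_mem hU he
    have hxB : ∀ e, e ∈ B → x.1.part e = B := fun e he => x.1.part_eq_of_mem hB he
    have hxC : ∀ e, e ∈ C → x.1.part e = C := fun e he => x.1.part_eq_of_mem hC he
    have hold : ∀ e ∈ Finset.Icc 1 (r * n + j), e ∉ B → e ∉ C → y.1.part e = x.1.part e := by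
      intro e he h1 h2
      have hp := x.1.part_mem.2 he
      have hs := x.1.mem_part_self.2 he
      exact y.1.part_eq_of_mem (h.mem_parts_iff.2
        (Or.inr ⟨hp, fun h => h1 (h ▸ hs), fun h => h2 (h ▸ hs)⟩)) hs
    have hmaxold : ∀ e ∈ Finset.Icc 1 (r * n + j), e ∉ B →
        blockMax (y.1.part e) = blockMax (x.1.part e) := by
      intro e he h1
      by_cases h2 : e ∈ C
      · rw [hyU e (Finset.mem_union_right _ h2), hxC e h2, hUmax]
      · rw [hold e he h1 h2]
    have hmemB : ∀ e ∈ Finset.Icc 1 (r * n + j), ∀ f, x.1.part e = x.1.part f → f ∈ B → e ∈ B := by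
      intro e he f hef hf
      rw [hxB f hf] at hef
      rw [← hef]
      exact x.1.mem_part_self.2 he
    -- A block of a later partition that meets `B` contains `C` as well, whose maximum is larger.
    have hmaxB : ∀ z ∈ y :: l, ∀ a ∈ Finset.Icc 1 (r * n + j), blockMax (z.1.part a) ∉ B := by
      intro z hz a ha hm
      have haz := blockMax_mem (z.1.part_nonempty.2 ha)
      have hle : B ∪ C ⊆ z.1.part a := by
        obtain ⟨Z, hZ, hUZ⟩ := hyz z hz hU
        rwa [z.1.part_eq_of_mem (z.1.part_mem.2 ha) haz |>.symm.trans
          (z.1.part_eq_of_mem hZ (hUZ (Finset.mem_union_left _ hm)))]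
      have h1 := ExtendedPartition.le_blockMax (hle (Finset.mem_union_right _ hCm))
      have h2 := ExtendedPartition.le_blockMax hm
      omega
    set idx' : ℕ → ℕ := fun e => if e ∈ B then 2 * idx e else 2 * idx e + 1 with hidx'
    have hin : ∀ e, e ∈ B → idx' e = 2 * idx e := fun e he => if_pos he
    have hout : ∀ e, e ∉ B → idx' e = 2 * idx e + 1 := fun e he => if_neg he
    have hle : ∀ a b, idx' a ≤ idx' b → idx a ≤ idx b := by
      intro a b hab
      by_cases ha : a ∈ B <;> by_cases hb : b ∈ B <;>
        simp only [hin, hout, ha, hb, not_false_eq_true] at hab <;> omega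
    have heq : ∀ a ∈ Finset.Icc 1 (r * n + j), ∀ b ∈ Finset.Icc 1 (r * n + j),
        idx' a = idx' b ↔ x.1.part a = x.1.part b := by
      intro a ha b hb
      have h1 := hi.eq_iff a ha b hb
      constructor
      · intro hab
        have h2 := h1.1 (le_antisymm (hle _ _ hab.le) (hle _ _ hab.ge))
        by_cases haB : a ∈ B <;> by_cases hbB : b ∈ B
        · rw [hxB a haB, hxB b hbB]
        · rw [hin a haB, hout b hbB] at hab
          omega
        · rw [hout a haB, hin b hbB] at hab
          omega
        · have key : ∀ e ∈ Finset.Icc 1 (r * n + j), ∀ f, y.1.part e = y.1.part f → f ∈ C →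
              e ∉ B → e ∈ C := by
            intro e he f hef hf heB
            rw [hyU f (Finset.mem_union_right _ hf)] at hef
            have := y.1.mem_part_self.2 he
            rw [hef] at this
            exact (Finset.mem_union.1 this).resolve_left heB
          by_cases haC : a ∈ C
          · rw [hxC a haC, hxC b (key b hb a h2.symm haC hbB)]
          · have hbC : b ∉ C := fun hbC => haC (key a ha b h2 hbC haB)
            rw [← hold a ha haB haC, h2, hold b hb hbB hbC]
      · intro hab
        have h2 : idx a = idx b := h1.2 (Finpartition.part_eq_part_of_le h.le
          (x.1.part_mem.2 ha) (x.1.mem_part_self.2 ha) (hab ▸ x.1.mem_part_self.2 hb))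
        by_cases haB : a ∈ B
        · rw [hin a haB, hin b (hmemB b hb a hab.symm haB), h2]
        · rw [hout a haB, hout b fun hbB => haB (hmemB a ha b hab hbB), h2]
    refine ⟨idx', heq, ?_, ?_, ?_, ?_⟩
    · intro z hz a ha
      rcases List.mem_cons.1 hz with rfl | hz
      · have hp := z.1.part_mem.2 ha
        have hm := blockMax_mem (z.1.part_nonempty.2 ha)
        exact ((heq a ha _ (z.1.subset hp hm)).2 (z.1.part_eq_of_mem hp hm).symm).le
      · have := hi.le_max z hz a ha
        rw [hout _ (hmaxB z hz a ha)]
        by_cases haB : a ∈ B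
        · rw [hin a haB]; omega
        · rw [hout a haB]; omega
    · intro z hz a ha c hc h1 h2
      rcases List.mem_cons.1 hz with rfl | hz
      · have hp := z.1.part_mem.2 ha
        have hm := blockMax_mem (z.1.part_nonempty.2 ha)
        have := (heq a ha _ (z.1.subset hp hm)).2 (z.1.part_eq_of_mem hp hm).symm
        exact (heq c hc a ha).1 (by omega)
      · exact hi.convex z hz a ha c hc (hle _ _ h1) (hle _ _ h2)
    · intro a ha b hb hab hcons
      by_cases haB : a ∈ B
      · rw [hxB a haB]
        by_cases hbC : b ∈ C
        · rwa [hxC b hbC]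
        · exfalso
          have hbB : b ∉ B := fun hbB => hab.ne ((heq a ha b hb).2 (by rw [hxB a haB, hxB b hbB]))
          have h1 : idx a ≠ idx b := fun he => by
            have h2 := (hi.eq_iff a ha b hb).1 he
            rw [hyU a (Finset.mem_union_left _ haB), hold b hb hbB hbC] at h2
            have h3 := x.1.mem_part_self.2 hb
            rw [← h2, Finset.mem_union] at h3
            tauto
          have h2 := hle _ _ hab.le
          have h3 : idx (blockMax C) = idx a := (hi.eq_iff _ hCI a ha).2 (by
            rw [hyU a (Finset.mem_union_left _ haB), hyU _ (Finset.mem_union_right _ hCm)])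
          have hCB : blockMax C ∉ B := fun h => hdis _ h hCm
          have h4 := hcons _ hCI (by rw [hin a haB, hout _ hCB]; omega)
          rw [hout b hbB, hout _ hCB] at h4
          omega
      · have hxaB : x.1.part a ≠ B := fun he => haB (he ▸ x.1.mem_part_self.2 ha)
        rw [hout a haB] at hab
        by_cases hbB : b ∈ B
        · rw [hxB b hbB, ← hmaxold a ha haB]
          have h1 := hl.le_blockMax hj (y.1.part_mem.2 ha)
          have h2 : blockMax B ≠ blockMax (y.1.part a) := by
            rw [hmaxold a ha haB]
            exact blockMax_ne hB (x.1.part_mem.2 ha) hxaB.symm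
          have h3 := blockMin_le_blockMax (x.1.nonempty_of_mem_parts hB)
          omega
        · rw [hout b hbB] at hab
          have hbC : b ∉ C := by
            intro hbC
            have h3 : idx (blockMax B) = idx b := (hi.eq_iff _ hBI b hb).2 (by
              rw [hyU b (Finset.mem_union_right _ hbC), hyU _ (Finset.mem_union_left _ hBm)])
            have h4 := hcons _ hBI (by rw [hout a haB, hin _ hBm]; omega)
            rw [hout b hbB, hin _ hBm] at h4
            omega
          rw [← hold b hb hbB hbC, ← hmaxold a ha haB]
          refine hi.overlap a ha b hb (by omega) fun c hc hac => ?_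
          by_cases hcB : c ∈ B
          · have := hcons c hc (by rw [hout a haB, hin c hcB]; omega)
            exact hle _ _ this
          · have := hcons c hc (by rw [hout a haB, hout c hcB]; omega)
            exact hle _ _ this
    · intro z hz a ha b hb h1 h2 h3
      rcases List.mem_cons.1 hz with rfl | hz
      · exact absurd h1 h2
      · by_cases haB : a ∈ B
        · rw [hxB a haB] at h1
          -- As `y` refines `z`, `b` is also a block maximum of `y`, hence at least `max B = a`.
          have hyb : blockMax (y.1.part b) = b := by
            refine blockMax_eq (y.1.mem_part_self.2 hb) fun e he => ?_
            rw [← h3]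
            exact ExtendedPartition.le_blockMax
              (Finpartition.part_subset_part (show y.1 ≤ z.1 from hyz z hz) b he)
          have h4 := hl.le_blockMax hj (y.1.part_mem.2 hb)
          rw [hyb, h1] at h4
          refine lt_of_le_of_ne h4 ?_
          rintro rfl
          exact h2 h3
        · rw [← hmaxold a ha haB] at h1
          exact hi.lt_max z hz a ha b hb h1 h2 h3

/-! ### The permutation of a falling chain -/

/-- The position of `e` in the arrangement of `s` by increasing `(idx e, e)`. -/
def position (s : Finset ℕ) (idx : ℕ → ℕ) (e : ℕ) : ℕ :=
  if e ∈ s then (s.filter fun f => idx f < idx e ∨ idx f = idx e ∧ f ≤ e).card else e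

section Position

variable {s : Finset ℕ} {idx : ℕ → ℕ} {a b : ℕ}

theorem position_lt_position_iff (ha : a ∈ s) (hb : b ∈ s) :
    position s idx a < position s idx b ↔ idx a < idx b ∨ idx a = idx b ∧ a < b := by
  have key : ∀ a ∈ s, ∀ b ∈ s, (idx a < idx b ∨ idx a = idx b ∧ a ≤ b) →
      position s idx a ≤ position s idx b := by
    intro a ha b hb h
    rw [position, position, if_pos ha, if_pos hb]
    refine Finset.card_le_card fun f hf => ?_
    rw [Finset.mem_filter] at hf ⊢
    exact ⟨hf.1, by omega⟩
  constructor
  · intro h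
    by_contra hcon
    have := key b hb a ha (by omega)
    omega
  · intro h
    rw [position, position, if_pos ha, if_pos hb]
    refine Finset.card_lt_card ⟨fun f hf => ?_, fun hcon => ?_⟩
    · rw [Finset.mem_filter] at hf ⊢
      exact ⟨hf.1, by omega⟩
    · have := hcon (Finset.mem_filter.2 ⟨hb, Or.inr ⟨rfl, le_rfl⟩⟩)
      rw [Finset.mem_filter] at this
      omega

theorem bijective_position (m : ℕ) (idx : ℕ → ℕ) :
    Function.Bijective (position (Finset.Icc 1 m) idx) := by
  have hmaps : ∀ a ∈ Finset.Icc 1 m, position (Finset.Icc 1 m) idx a ∈ Finset.Icc 1 m := by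
    intro a ha
    rw [position, if_pos ha, Finset.mem_Icc]
    constructor
    · exact Finset.card_pos.2 ⟨a, Finset.mem_filter.2 ⟨ha, Or.inr ⟨rfl, le_rfl⟩⟩⟩
    · exact (Finset.card_filter_le _ _).trans (by simp)
  have hid : ∀ a ∉ Finset.Icc 1 m, position (Finset.Icc 1 m) idx a = a := fun a ha => if_neg ha
  have hinj : ∀ a ∈ Finset.Icc 1 m, ∀ b ∈ Finset.Icc 1 m,
      position (Finset.Icc 1 m) idx a = position (Finset.Icc 1 m) idx b → a = b := by
    intro a ha b hb h
    have h1 := position_lt_position_iff (idx := idx) ha hb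
    have h2 := position_lt_position_iff (idx := idx) hb ha
    omega
  constructor
  · intro a b h
    by_cases ha : a ∈ Finset.Icc 1 m <;> by_cases hb : b ∈ Finset.Icc 1 m
    · exact hinj a ha b hb h
    · exact absurd (hid b hb ▸ h ▸ hmaps a ha) hb
    · exact absurd (hid a ha ▸ h ▸ hmaps b hb) ha
    · rwa [hid a ha, hid b hb] at h
  · intro b
    by_cases hb : b ∈ Finset.Icc 1 m
    · obtain ⟨a, -, h⟩ := Finset.surj_on_of_inj_on_of_card_le (s := Finset.Icc 1 m)
        (t := Finset.Icc 1 m) (fun a _ => position (Finset.Icc 1 m) idx a) hmaps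
        (fun a b ha hb h => hinj a ha b hb h) le_rfl b hb
      exact ⟨a, h.symm⟩
    · exact ⟨b, hid b hb⟩

/-- The permutation that arranges `1, …, m` by increasing `(idx e, e)`. -/
noncomputable def arrangement (m : ℕ) (idx : ℕ → ℕ) : Equiv.Perm ℕ :=
  (Equiv.ofBijective _ (bijective_position m idx)).symm

theorem arrangement_symm_apply (m : ℕ) (idx : ℕ → ℕ) (e : ℕ) :
    (arrangement m idx).symm e = position (Finset.Icc 1 m) idx e := rfl

theorem arrangement_apply_of_notMem {m i : ℕ} (h : i ∉ Finset.Icc 1 m) :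
    arrangement m idx i = i := by
  rw [← Equiv.eq_symm_apply, arrangement_symm_apply, position, if_neg h]

theorem arrangement_apply_mem {m i : ℕ} (h : i ∈ Finset.Icc 1 m) :
    arrangement m idx i ∈ Finset.Icc 1 m := by
  by_contra hn
  have := arrangement_apply_of_notMem (idx := idx) hn
  rw [(arrangement m idx).injective this] at hn
  exact hn h

end Position

namespace IsBlockOrder

variable {x : AdmPart r n j} {l : List (AdmPart r n j)} {idx : ℕ → ℕ}

/-- The condition `le_max` for the one-block partition puts the block of `m` last. -/
theorem idx_le_max (hj : 0 < j) (h : IsBlockOrder x l idx) (htop : ⊤ ∈ x :: l) {a : ℕ}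
    (ha : a ∈ Finset.Icc 1 (r * n + j)) : idx a ≤ idx (r * n + j) := by
  have h1 := h.le_max ⊤ htop a ha
  have h2 : blockMax ((⊤ : AdmPart r n j).1.part a) = r * n + j := by
    have hmI := max_mem_Icc (r := r) (n := n) hj
    refine blockMax_eq ?_ fun b hb => (Finset.mem_Icc.1 (Finpartition.part_subset _ _ hb)).2
    have := Finpartition.parts_top_subsingleton (Finset.Icc 1 (r * n + j))
      ((Finpartition.part_mem _).2 ha) ((Finpartition.part_mem _).2 hmI)
    show r * n + j ∈ (⊤ : Part r n j).part a
    rw [this]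
    exact (Finpartition.mem_part_self _).2 hmI
  rwa [h2] at h1

theorem position_max (hj : 0 < j) (h : IsBlockOrder x l idx) (htop : ⊤ ∈ x :: l) :
    position (Finset.Icc 1 (r * n + j)) idx (r * n + j) = r * n + j := by
  rw [position, if_pos (max_mem_Icc hj), Finset.filter_true_of_mem]
  · simp
  · intro a ha
    have h1 := h.idx_le_max hj htop ha
    have h2 := (Finset.mem_Icc.1 ha).2
    omega

/-- The elements of `{1, …, m - 1}` that are the maxima of their blocks. -/
def innerMaxima (z : Part r n j) : Finset ℕ :=
  (Finset.Icc 1 (r * n + j)).filter fun e => blockMax (z.part e) = e ∧ e ≠ r * n + j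

theorem mem_innerMaxima {z : Part r n j} {e : ℕ} : e ∈ innerMaxima z ↔
    e ∈ Finset.Icc 1 (r * n + j) ∧ blockMax (z.part e) = e ∧ e ≠ r * n + j := by
  rw [innerMaxima, Finset.mem_filter]

theorem card_innerMaxima (hj : 0 < j) (z : Part r n j) :
    (innerMaxima z).card = z.parts.card - 1 := by
  have hmI := max_mem_Icc (r := r) (n := n) hj
  have hmax : blockMax (z.part (r * n + j)) = r * n + j :=
    blockMax_eq (z.mem_part_self.2 hmI)
      fun a ha => (Finset.mem_Icc.1 (z.part_subset _ ha)).2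
  have himg : innerMaxima z = (z.parts.image blockMax).erase (r * n + j) := by
    ext e
    rw [mem_innerMaxima, Finset.mem_erase, Finset.mem_image]
    constructor
    · rintro ⟨h1, h2, h3⟩
      exact ⟨h3, _, z.part_mem.2 h1, h2⟩
    · rintro ⟨h1, D, hD, rfl⟩
      have hm := blockMax_mem (z.nonempty_of_mem_parts hD)
      exact ⟨z.subset hD hm, by rw [z.part_eq_of_mem hD hm], h1⟩
  rw [himg, Finset.card_erase_of_mem (Finset.mem_image.2 ⟨_, z.part_mem.2 hmI, hmax⟩),
    Finset.card_image_of_injOn]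
  intro B hB C hC he
  by_contra hne
  exact blockMax_ne hB hC hne he

/-- The letters up to a block maximum fill whole blocks of size `r`, since the block of `m` comes
last and is not among them. -/
theorem position_of_mem_innerMaxima (hj : 0 < j) (h : IsBlockOrder x l idx) (htop : ⊤ ∈ x :: l)
    (hx : HasMinimalBlocks x.1) {e : ℕ} (he : e ∈ innerMaxima x.1) :
    ∃ t, 1 ≤ t ∧ t ≤ n ∧ position (Finset.Icc 1 (r * n + j)) idx e = r * t := by
  obtain ⟨heI, hemax, hem⟩ := mem_innerMaxima.1 he
  have hmI := max_mem_Icc (r := r) (n := n) hj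
  rw [position, if_pos heI]
  set s := Finset.Icc 1 (r * n + j) with hs
  set F := s.filter fun f => idx f < idx e ∨ idx f = idx e ∧ f ≤ e with hF
  have hmemF : ∀ f ∈ s, f ∈ F ↔ idx f ≤ idx e := by
    intro f hf
    rw [hF, Finset.mem_filter]
    constructor
    · omega
    · intro hle
      refine ⟨hf, hle.lt_or_eq.imp id fun heq => ⟨heq, ?_⟩⟩
      rw [h.eq_iff f hf e heI] at heq
      conv_rhs => rw [← hemax]
      rw [← heq]
      exact le_blockMax (x.1.mem_part_self.2 hf)
  have hFI : F ⊆ s := Finset.filter_subset _ _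
  have hsub : ∀ f ∈ F, x.1.part f ⊆ F := by
    intro f hf g hg
    have hfI := hFI hf
    have hgI := x.1.part_subset _ hg
    rw [hmemF g hgI]
    rw [hmemF f hfI] at hf
    rw [(h.eq_iff g hgI f hfI).2 ((x.1.mem_part_iff_part_eq_part hgI hfI).1 hg)]
    exact hf
  have hmF : r * n + j ∉ F := by
    rw [hmemF _ hmI]
    intro hle
    have := (h.eq_iff e heI _ hmI).1 (le_antisymm (h.idx_le_max hj htop heI) hle)
    rw [this] at hemax
    have := le_blockMax (x.1.mem_part_self.2 hmI)
    have := (Finset.mem_Icc.1 heI).2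
    omega
  have hdvd : r ∣ F.card := by
    rw [Finset.card_eq_sum_card_fiberwise (f := x.1.part) (t := x.1.parts)
      fun f hf => x.1.part_mem.2 (hFI hf)]
    refine Finset.dvd_sum fun D hD => ?_
    by_cases hDF : D ⊆ F
    · have : F.filter (fun f => x.1.part f = D) = D := by
        ext f
        rw [Finset.mem_filter, x.1.part_eq_iff_mem hD]
        exact ⟨fun h => h.2, fun h => ⟨hDF h, h⟩⟩
      rw [this, (hx D hD).2 fun h => hmF (hDF h)]
    · have : F.filter (fun f => x.1.part f = D) = ∅ := by
        rw [Finset.filter_eq_empty_iff]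
        rintro f hf rfl
        exact hDF (hsub f hf)
      simp [this]
  obtain ⟨t, ht⟩ := hdvd
  have hpos : 0 < F.card := Finset.card_pos.2 ⟨e, (hmemF e heI).2 le_rfl⟩
  have hle : F.card + j ≤ r * n + j := by
    have hd : Disjoint F (x.1.part (r * n + j)) := by
      rw [Finset.disjoint_left]
      intro f hf hfm
      have hfI := hFI hf
      refine hmF (hsub f hf ?_)
      rw [(x.1.mem_part_iff_part_eq_part hfI hmI).1 hfm]
      exact x.1.mem_part_self.2 hmI
    have := Finset.card_le_card (Finset.union_subset hFI (x.1.part_subset (r * n + j)))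
    rw [Finset.card_union_of_disjoint hd,
      (hx _ (x.1.part_mem.2 hmI)).1 (x.1.mem_part_self.2 hmI)] at this
    simpa [hs] using this
  refine ⟨t, ?_, ?_, ht⟩
  · by_contra h0
    obtain rfl : t = 0 := by omega
    omega
  · have hr : 0 < r := Nat.pos_of_ne_zero fun h0 => by
      rw [h0, zero_mul] at ht
      omega
    rw [ht] at hle
    exact Nat.le_of_mul_le_mul_left (by omega) hr

/-- There are `n` inner maxima at distinct positions among `r, 2r, …, nr`, so every one of these
positions occurs. -/
theorem exists_innerMaxima_eq (hr : 0 < r) (hj : 0 < j) (h : IsBlockOrder x l idx)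
    (htop : ⊤ ∈ x :: l) (hx : HasMinimalBlocks x.1) {t : ℕ} (ht1 : 1 ≤ t) (htn : t ≤ n) :
    ∃ e ∈ innerMaxima x.1, position (Finset.Icc 1 (r * n + j)) idx e = r * t := by
  have hinj := (bijective_position (r * n + j) idx).injective
  have hsub : (innerMaxima x.1).image (position (Finset.Icc 1 (r * n + j)) idx) ⊆
      (Finset.Icc 1 n).image (r * ·) := by
    intro p hp
    obtain ⟨e, he, rfl⟩ := Finset.mem_image.1 hp
    obtain ⟨t, h1, h2, h3⟩ := h.position_of_mem_innerMaxima hj htop hx he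
    exact Finset.mem_image.2 ⟨t, Finset.mem_Icc.2 ⟨h1, h2⟩, h3.symm⟩
  have heq := Finset.eq_of_subset_of_card_le hsub (by
    rw [Finset.card_image_of_injective _ hinj, card_innerMaxima hj,
      (card_parts_eq_iff hr hj x).2 hx]
    exact Finset.card_image_le.trans (by simp))
  have hmem : r * t ∈ (Finset.Icc 1 n).image (r * ·) :=
    Finset.mem_image.2 ⟨t, Finset.mem_Icc.2 ⟨ht1, htn⟩, rfl⟩
  rw [← heq] at hmem
  simpa using hmem

/-- Letters increase within a block. At a change of block, a maximum is followed by the minimum of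
the next block, and the overlap makes this a descent. -/
theorem arrangement_mem_descPerms (hr : 0 < r) (hj : 0 < j) (h : IsBlockOrder x l idx)
    (htop : ⊤ ∈ x :: l) (hx : HasMinimalBlocks x.1) :
    arrangement (r * n + j) idx ∈ descPerms r n j := by
  have hmI := max_mem_Icc (r := r) (n := n) hj
  have hposm := h.position_max hj htop
  set σ := arrangement (r * n + j) idx with hσ
  have hsymm : ∀ e, position (Finset.Icc 1 (r * n + j)) idx e = σ.symm e := fun e =>
    (arrangement_symm_apply _ _ _).symm
  have hlt : ∀ a ∈ Finset.Icc 1 (r * n + j), ∀ b ∈ Finset.Icc 1 (r * n + j),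
      (σ.symm a < σ.symm b ↔ idx a < idx b ∨ idx a = idx b ∧ a < b) := fun a ha b hb => by
    rw [← hsymm, ← hsymm]
    exact position_lt_position_iff ha hb
  have hinner : ∀ e ∈ innerMaxima x.1, ∀ f ∈ Finset.Icc 1 (r * n + j), idx e = idx f → f ≤ e := by
    intro e he f hf hef
    obtain ⟨heI, hemax, hem⟩ := mem_innerMaxima.1 he
    rw [h.eq_iff e heI f hf] at hef
    conv_rhs => rw [← hemax]
    rw [hef]
    exact le_blockMax (x.1.mem_part_self.2 hf)
  rw [hsymm] at hposm
  have hσm : σ (r * n + j) = r * n + j := by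
    conv_lhs => rw [← hposm]
    exact σ.apply_symm_apply _
  -- consecutive letters in different blocks
  have hstep : ∀ i, 1 ≤ i → i < r * n + j → idx (σ i) ≠ idx (σ (i + 1)) →
      σ (i + 1) < σ i ∧ σ i ∈ innerMaxima x.1 := by
    intro i hi him hne
    have he : σ i ∈ Finset.Icc 1 (r * n + j) :=
      arrangement_apply_mem (Finset.mem_Icc.2 ⟨hi, him.le⟩)
    have hf : σ (i + 1) ∈ Finset.Icc 1 (r * n + j) :=
      arrangement_apply_mem (Finset.mem_Icc.2 ⟨by omega, by omega⟩)
    have hp1 : σ.symm (σ i) = i := σ.symm_apply_apply i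
    have hp2 : σ.symm (σ (i + 1)) = i + 1 := σ.symm_apply_apply _
    have hidx : idx (σ i) < idx (σ (i + 1)) := by
      have := (hlt _ he _ hf).1 (by omega)
      omega
    have hov := h.overlap _ he _ hf hidx fun c hc hac => by
      by_contra hcb
      have h1 := (hlt _ he c hc).2 (Or.inl hac)
      have h2 := (hlt c hc _ hf).2 (Or.inl (by omega))
      omega
    have hne1 := x.1.part_nonempty.2 he
    have hne2 := x.1.part_nonempty.2 hf
    have hM := blockMax_mem hne1
    have hMI := x.1.part_subset _ hM
    have hL := blockMin_mem hne2
    have hLI := x.1.part_subset _ hL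
    have hMidx : idx (blockMax (x.1.part (σ i))) = idx (σ i) :=
      (h.eq_iff _ hMI _ he).2 ((x.1.mem_part_iff_part_eq_part hMI he).1 hM)
    have hLidx : idx (blockMin (x.1.part (σ (i + 1)))) = idx (σ (i + 1)) :=
      (h.eq_iff _ hLI _ hf).2 ((x.1.mem_part_iff_part_eq_part hLI hf).1 hL)
    have hMe : blockMax (x.1.part (σ i)) = σ i := by
      by_contra hcon
      have h0 := le_blockMax (x.1.mem_part_self.2 he)
      have h1 := (hlt _ he _ hMI).2 (Or.inr ⟨hMidx.symm, by omega⟩)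
      have h2 := (hlt _ hMI _ hf).2 (Or.inl (by omega))
      omega
    have hLf : blockMin (x.1.part (σ (i + 1))) = σ (i + 1) := by
      by_contra hcon
      have h0 := blockMin_le (x.1.mem_part_self.2 hf)
      have h1 := (hlt _ hLI _ hf).2 (Or.inr ⟨hLidx, by omega⟩)
      have h2 := (hlt _ he _ hLI).2 (Or.inl (by omega))
      omega
    refine ⟨by omega, mem_innerMaxima.2 ⟨he, hMe, fun hem => ?_⟩⟩
    rw [hem, hposm] at hp1
    omega
  refine ⟨fun i hi => arrangement_apply_of_notMem hi, fun i => ⟨?_, ?_⟩, hσm⟩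
  · rintro ⟨hi, him, hdes⟩
    have he : σ i ∈ Finset.Icc 1 (r * n + j) :=
      arrangement_apply_mem (Finset.mem_Icc.2 ⟨hi, him.le⟩)
    have hf : σ (i + 1) ∈ Finset.Icc 1 (r * n + j) :=
      arrangement_apply_mem (Finset.mem_Icc.2 ⟨by omega, by omega⟩)
    have hlt' := (hlt _ he _ hf).1 (by rw [σ.symm_apply_apply, σ.symm_apply_apply]; omega)
    obtain ⟨-, hmem⟩ := hstep i hi him (by omega)
    obtain ⟨t, h1, h2, h3⟩ := h.position_of_mem_innerMaxima hj htop hx hmem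
    rw [hsymm, σ.symm_apply_apply] at h3
    exact ⟨t, h1, h2, h3⟩
  · rintro ⟨t, ht1, htn, rfl⟩
    have h1 := Nat.mul_pos hr ht1
    have h2 := Nat.mul_le_mul_left r htn
    obtain ⟨e, he, hpe⟩ := h.exists_innerMaxima_eq hr hj htop hx ht1 htn
    have hse : σ (r * t) = e := by
      rw [← hpe, hsymm, σ.apply_symm_apply]
    refine ⟨h1, by omega, (hstep _ h1 (by omega) fun hidx => ?_).1⟩
    have hf : σ (r * t + 1) ∈ Finset.Icc 1 (r * n + j) :=
      arrangement_apply_mem (Finset.mem_Icc.2 ⟨by omega, by omega⟩)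
    rw [hse] at hidx
    have h3 := hinner e he _ hf hidx
    have h4 := (hlt e (mem_innerMaxima.1 he).1 _ hf).1 (by
      rw [σ.symm_apply_apply, ← hsymm, hpe]; omega)
    omega

/-- A partition of the chain is obtained by splitting the permutation after its block maxima. -/
theorem eq_splitAt (hj : 0 < j) (h : IsBlockOrder x l idx) (htop : ⊤ ∈ x :: l)
    (hle : ∀ z ∈ x :: l, x ≤ z) {z : AdmPart r n j}
    (hz : z ∈ x :: l) {S : List ℕ}
    (hS : ∀ s, s ∈ S ↔ ∃ e ∈ innerMaxima z.1, (arrangement (r * n + j) idx).symm e = s) :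
    z.1 = splitAt r n j (arrangement (r * n + j) idx) S := by
  have hmI := max_mem_Icc (r := r) (n := n) hj
  have hposm := h.position_max hj htop
  rw [← arrangement_symm_apply] at hposm
  set σ := arrangement (r * n + j) idx with hσ
  have hlt : ∀ a ∈ Finset.Icc 1 (r * n + j), ∀ b ∈ Finset.Icc 1 (r * n + j),
      (σ.symm a < σ.symm b ↔ idx a < idx b ∨ idx a = idx b ∧ a < b) :=
    fun a ha b hb => position_lt_position_iff ha hb
  suffices hs : ∀ a ∈ Finset.Icc 1 (r * n + j), ∀ b ∈ Finset.Icc 1 (r * n + j),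
      σ.symm a ≤ σ.symm b → (z.1.part a = z.1.part b ↔ ∀ s ∈ S, s < σ.symm a ↔ s < σ.symm b) by
    refine Finpartition.eq_of_part fun a ha b hb => ?_
    rw [part_splitAt_eq_iff _ ha hb]
    rcases le_total (σ.symm a) (σ.symm b) with hab | hab
    · exact hs a ha b hb hab
    · rw [eq_comm, hs b hb a ha hab]
      simp only [iff_comm]
  intro a ha b hb hab
  have hne := z.1.part_nonempty.2 ha
  have hM := blockMax_mem hne
  have hMI := z.1.part_subset _ hM
  have hMpart : z.1.part (blockMax (z.1.part a)) = z.1.part a :=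
    (z.1.mem_part_iff_part_eq_part hMI ha).1 hM
  constructor
  · intro hpart s hs
    refine ⟨fun h' => by omega, fun h' => ?_⟩
    by_contra hcon
    obtain ⟨e, he, rfl⟩ := (hS s).1 hs
    obtain ⟨heI, hemax, -⟩ := mem_innerMaxima.1 he
    have h1 := (hlt e heI b hb).1 h'
    have h2 : ¬ (idx e < idx a ∨ idx e = idx a ∧ e < a) := fun h => hcon ((hlt e heI a ha).2 h)
    have h3 := h.le_max z hz b hb
    rw [← hpart] at h3
    -- A cut `e` between `a` and `b` lies in their common block by convexity and is its maximum; so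
    -- `b ≤ e`, and `b` cannot come after `e`.
    have h4 := h.convex z hz a ha e heI (by omega) (by omega)
    rw [h4] at hemax
    have hbM : b ≤ e := by
      rw [← hemax, hpart]
      exact le_blockMax (z.1.mem_part_self.2 hb)
    rw [hemax] at h3
    omega
  · intro hcut
    by_contra hpart
    have hxz : x.1 ≤ z.1 := hle z hz
    -- By convexity the block of `a` ends before `b`, so its maximum is a cut between them.
    have hMb : σ.symm (blockMax (z.1.part a)) < σ.symm b := by
      by_contra hcon
      rw [hlt _ hMI b hb] at hcon
      have h1 : ¬ (idx b < idx a ∨ idx b = idx a ∧ b < a) := fun h => by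
        have := (hlt b hb a ha).2 h
        omega
      exact hpart (h.convex z hz a ha b hb (by omega) (by omega)).symm
    have hmem : blockMax (z.1.part a) ∈ innerMaxima z.1 := by
      refine mem_innerMaxima.2 ⟨hMI, by rw [hMpart], fun hm => ?_⟩
      rw [hm, hposm] at hMb
      have h2 : idx b ≤ idx (r * n + j) := h.idx_le_max hj htop hb
      have h3 := (hlt _ hmI b hb).1 (by rw [hposm]; exact hMb)
      have h4 := (Finset.mem_Icc.1 hb).2
      omega
    have h1 := (hcut _ ((hS _).2 ⟨_, hmem, rfl⟩)).2 hMb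
    have h2 := (hlt _ hMI a ha).1 h1
    have h3 := h.le_max z hz a ha
    have h4 := le_blockMax (z.1.mem_part_self.2 ha)
    omega

end IsBlockOrder

/-- If `U` consists of `k` elements of `1, …, n` with larger values `σ (r t)` than the remaining
elements, then `U = {t₁, …, tₖ}`. -/
theorem mem_take_descOrder_iff {σ : Equiv.Perm ℕ} (hr : 0 < r) {U : Finset ℕ}
    (hU : ∀ t ∈ U, 1 ≤ t ∧ t ≤ n)
    (hup : ∀ t ∈ U, ∀ u, 1 ≤ u → u ≤ n → u ∉ U → σ (r * u) < σ (r * t)) {t : ℕ} :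
    t ∈ (descOrder r n σ).take U.card ↔ t ∈ U := by
  set L := (descOrder r n σ).take U.card with hL
  have hnd : L.Nodup := nodup_descOrder.sublist (List.take_sublist _ _)
  have hUn : U.card ≤ n := by
    have := Finset.card_le_card (show U ⊆ Finset.Icc 1 n from fun t ht =>
      Finset.mem_Icc.2 (hU t ht))
    simpa using this
  have hcard : L.toFinset.card = U.card := by
    rw [List.toFinset_card_of_nodup hnd, hL, List.length_take, length_descOrder]
    omega
  have hsub : L.toFinset ⊆ U := by
    intro t ht
    by_contra htU
    obtain ⟨u, hu, huL⟩ : ∃ u ∈ U, u ∉ L.toFinset := by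
      by_contra! hcon
      have := Finset.eq_of_subset_of_card_le hcon hcard.le
      exact htU (this ▸ ht)
    rw [List.mem_toFinset] at ht huL
    have h1 := lt_of_mem_take hr ht (hU u hu) huL
    have h2 := mem_descOrder.1 (List.mem_of_mem_take ht)
    exact (h1.trans (hup u hu t h2.1 h2.2 htU)).false
  rw [← Finset.eq_of_subset_of_card_le hsub hcard.ge, List.mem_toFinset]

namespace IsBlockOrder

variable {x : AdmPart r n j} {l : List (AdmPart r n j)} {idx : ℕ → ℕ}

/-- The inner maxima of `z` are inner maxima of `x`, and by `lt_max` the largest ones; so their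
positions are the first entries of `descOrder`, multiplied by `r`. -/
theorem eq_splitAt_topCuts (hr : 0 < r) (hj : 0 < j) (h : IsBlockOrder x l idx)
    (htop : ⊤ ∈ x :: l) (hle : ∀ z ∈ x :: l, x ≤ z) (hx : HasMinimalBlocks x.1)
    {z : AdmPart r n j} (hz : z ∈ x :: l) :
    z.1 = splitAt r n j (arrangement (r * n + j) idx)
      (topCuts r n (arrangement (r * n + j) idx) (z.1.parts.card - 1)) := by
  set σ := arrangement (r * n + j) idx with hσ
  have hsymm : ∀ e, position (Finset.Icc 1 (r * n + j)) idx e = σ.symm e := fun e =>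
    (arrangement_symm_apply _ _ _).symm
  have hzx : ∀ e ∈ innerMaxima z.1, e ∈ innerMaxima x.1 := by
    intro e he
    obtain ⟨h1, h2, h3⟩ := mem_innerMaxima.1 he
    refine mem_innerMaxima.2 ⟨h1, blockMax_eq (x.1.mem_part_self.2 h1) fun a ha => ?_, h3⟩
    conv_rhs => rw [← h2]
    exact le_blockMax (Finpartition.part_subset_part (show x.1 ≤ z.1 from hle z hz) e ha)
  let U := (Finset.Icc 1 n).filter fun t => σ (r * t) ∈ innerMaxima z.1
  have hmemU : ∀ t, t ∈ U ↔ (1 ≤ t ∧ t ≤ n) ∧ σ (r * t) ∈ innerMaxima z.1 := fun t => by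
    rw [Finset.mem_filter, Finset.mem_Icc]
  have himg : U.image (fun t => σ (r * t)) = innerMaxima z.1 := by
    ext e
    rw [Finset.mem_image]
    constructor
    · rintro ⟨t, ht, rfl⟩
      exact ((hmemU t).1 ht).2
    · intro he
      obtain ⟨t, h1, h2, h3⟩ := h.position_of_mem_innerMaxima hj htop hx (hzx e he)
      have h4 : σ (r * t) = e := by rw [← h3, hsymm, σ.apply_symm_apply]
      exact ⟨t, (hmemU t).2 ⟨⟨h1, h2⟩, h4 ▸ he⟩, h4⟩
  have hcard : U.card = z.1.parts.card - 1 := by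
    rw [← card_innerMaxima hj, ← himg, Finset.card_image_of_injective]
    exact fun a b hab => Nat.eq_of_mul_eq_mul_left hr (σ.injective hab)
  have htake : ∀ t, t ∈ (descOrder r n σ).take U.card ↔ t ∈ U := fun t =>
    mem_take_descOrder_iff hr (fun t ht => ((hmemU t).1 ht).1) fun t ht u hu1 hun huU => by
      obtain ⟨h1, h2, h3⟩ := mem_innerMaxima.1 ((hmemU t).1 ht).2
      obtain ⟨e, he, hpe⟩ := h.exists_innerMaxima_eq hr hj htop hx hu1 hun
      have hse : σ (r * u) = e := by rw [← hpe, hsymm, σ.apply_symm_apply]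
      obtain ⟨e1, e2, e3⟩ := mem_innerMaxima.1 he
      rw [hse]
      refine h.lt_max z hz e e1 _ h1 e2 (fun hcon => huU ?_) h2
      exact (hmemU u).2 ⟨⟨hu1, hun⟩, hse ▸ mem_innerMaxima.2 ⟨e1, hcon, e3⟩⟩
  rw [← hcard]
  refine h.eq_splitAt hj htop hle hz fun s => ?_
  rw [topCuts, List.mem_map]
  constructor
  · rintro ⟨t, ht, rfl⟩
    exact ⟨_, ((hmemU t).1 ((htake t).1 ht)).2, σ.symm_apply_apply _⟩
  · rintro ⟨e, he, rfl⟩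
    rw [← himg, Finset.mem_image] at he
    obtain ⟨t, ht, rfl⟩ := he
    exact ⟨t, (htake t).2 ht, (σ.symm_apply_apply _).symm⟩

end IsBlockOrder

theorem exists_eq_cons_map_coe {d : List (Lat r n j)}
    (hd : IsMaximalChain ⊥ ⊤ d) : ∃ (x : AdmPart r n j) (l : List (AdmPart r n j)),
      d = ⊥ :: (x :: l).map WithBot.some := by
  obtain ⟨a, l, rfl, ha, hc⟩ := hd.exists_cons (WithBot.bot_lt_coe (⊤ : AdmPart r n j)).ne
  have hmem : ∀ z ∈ a :: l, ⊥ < z := by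
    have hp := (hc.2.2.imp fun {p q : Lat r n j} h => h.lt).pairwise
    rw [List.pairwise_cons] at hp
    intro z hz
    rcases List.mem_cons.1 hz with rfl | hz
    · exact ha.lt
    · exact ha.lt.trans (hp.1 z hz)
  obtain ⟨l', hl'⟩ : ∃ l' : List (AdmPart r n j), a :: l = l'.map WithBot.some := by
    have : ∀ L : List (Lat r n j), (∀ z ∈ L, ⊥ < z) →
        ∃ l' : List (AdmPart r n j), L = l'.map WithBot.some := by
      intro L
      induction L with
      | nil => exact fun _ => ⟨[], rfl⟩
      | cons b L ih =>
        intro h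
        obtain ⟨l', rfl⟩ := ih fun z hz => h z (List.mem_cons_of_mem _ hz)
        obtain ⟨b', rfl⟩ := WithBot.ne_bot_iff_exists.1 (h b List.mem_cons_self).ne'
        exact ⟨b' :: l', rfl⟩
    exact this _ hmem
  cases l' with
  | nil => simp at hl'
  | cons x l' => exact ⟨x, l', by rw [hl']⟩

theorem exists_mem_descPerms_of_isFalling (hr : 0 < r) (hj : 0 < j) {d : List (Lat r n j)}
    (hd : IsMaximalChain ⊥ ⊤ d) (hf : IsFalling pairLabel d) :
    ∃ σ ∈ descPerms r n j, fChain r n j σ = d.map Lat.val := by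
  obtain ⟨x, l, rfl⟩ := exists_eq_cons_map_coe hd
  obtain ⟨h1, h2, h3⟩ := hd
  rw [List.map_cons, List.isChain_cons_cons] at h3
  have hc : IsMaximalChain (x : Lat r n j) ⊤ ((x :: l).map WithBot.some) :=
    ⟨rfl, by simpa using h2, h3.2⟩
  have hx := (isMin_iff hr hj x).1 (WithBot.bot_covBy_coe.1 h3.1)
  have hfall : IsFallingFrom 0 x l :=
    isFallingFrom_of_isFalling (q := atomIndex x) (p := -(rank (⊥ : Lat r n j) : ℤ))
      (Nat.zero_le _) hc hf
  have htop : ⊤ ∈ x :: l := by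
    have := List.mem_of_getLast? hc.2.1
    obtain ⟨z, hz, he⟩ := List.mem_map.1 this
    have : z = ⊤ := WithBot.coe_injective he
    exact this ▸ hz
  obtain ⟨idx, h⟩ := hfall.exists_isBlockOrder hj
  refine ⟨arrangement (r * n + j) idx, h.arrangement_mem_descPerms hr hj htop hx, ?_⟩
  have hcard := hfall.map_card hj
  rw [(card_parts_eq_iff hr hj x).2 hx] at hcard
  rw [fChain, ← hcard, List.map_map, List.map_cons (f := Lat.val), List.map_map]
  refine congrArg _ (List.map_congr_left fun z hz => ?_)
  exact congrArg WithBot.some (h.eq_splitAt_topCuts hr hj htop hfall.le hx hz).symm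

end ExtendedPartition

theorem mainTheorem9 (r n j : ℕ) (hr : 0 < r) (hj : 0 < j) :
    EdgeLabeling.IsGraded (ExtendedPartition.Lat r n j) ∧
    EdgeLabeling.IsELLabeling
      (ExtendedPartition.pairLabel : ExtendedPartition.Lat r n j → ExtendedPartition.Lat r n j → _) ∧
    {c : List (WithBot (ExtendedPartition.Part r n j)) |
        ∃ d : List (ExtendedPartition.Lat r n j),
          EdgeLabeling.IsMaximalChain ⊥ ⊤ d ∧
          EdgeLabeling.IsFalling ExtendedPartition.pairLabel d ∧
          d.map ExtendedPartition.Lat.val = c} =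
      ExtendedPartition.fChain r n j '' ExtendedPartition.descPerms r n j := by
  refine ⟨ExtendedPartition.isGraded_lat hr hj, ExtendedPartition.isELLabeling_pairLabel hr hj, ?_⟩
  ext c
  constructor
  · rintro ⟨d, hd, hf, rfl⟩
    exact ExtendedPartition.exists_mem_descPerms_of_isFalling hr hj hd hf
  · rintro ⟨σ, hσ, rfl⟩
    exact ExtendedPartition.exists_chain_of_mem_descPerms hr hj hσ
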